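/- Let $n\ge 1$, let $\Omega\subset\mathbb{R}^n$ be a bounded Lipschitz domain, let $\delta(x)=\mathrm{dist}(x,\partial\Omega)$, let $q>1$ and $a<q-1$ be real numbers, and let $\mu(dx)=\delta(x)^a\,dx$ on $\Omega$. Here $|\nabla^{(2)}u|$ denotes the Euclidean (Frobenius) norm of the matrix of second derivatives of $u$, and $C_0^\infty(\Omega)$ is the space of smooth functions with compact support in $\Omega$. An $N$-function is a continuous convex function $M:[0,\infty)\to[0,\infty)$ with $M(\lambda)/\lambda\to 0$ as $\lambda\to 0^+$ and $M(\lambda)/\lambda\to\infty$ as $\lambda\to\infty$, and $\|f\|_{L^M(\Omega,\mu)}=\inf\{K>0:\int_\Omega M(|f|/K)\,d\mu\le 1\}$. i) If $p\ge 2$, $r>1$ and $\frac2p=\frac1q+\frac1r$, then there is a constant $c>0$ such that for every $u\in C_0^\infty(\Omega)$ $$\left(\int_\Omega|\nabla u|^p\delta^a\,dx\right)^{2/p}\le c\left(\int_\Omega|\nabla^{(2)}u|^q\delta^a\,dx\right)^{1/q}\left(\int_\Omega|u|^r\delta^a\,dx\right)^{1/r}.$$ ii) Let $M$ and $Q$ be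 $N$-functions such that, for some constant $c_0$, $\frac{M(s)}{s^2}vw\le M(s)+c_0v^q+Q(w)$ for all $s,v,w>0$. Suppose moreover that $M$ is of class $C^1$ on $(0,\infty)$, that $M(2\lambda)\le D M(\lambda)$ for some constant $D$ and all $\lambda>0$, and that $M'(\lambda)/\lambda$ is bounded near $0$. Then there is a constant $c>0$ such that for every $u\in C_0^\infty(\Omega)$ $$\int_\Omega M(|\nabla u|)\delta^a\,dx\le c\left(\int_\Omega|\nabla^{(2)}u|^q\delta^a\,dx+\int_\Omega Q(|u|)\delta^a\,dx\right)$$ and $$\|\nabla u\|_{L^M(\Omega,\mu)}^2\le c\,\|\nabla^{(2)}u\|_{L^q(\Omega,\mu)}\,\|u\|_{L^Q(\Omega,\mu)}.$$ -/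

import Mathlib

open scoped ENNReal ContDiff

noncomputable section

namespace WeightedGN

/-- Euclidean space `ℝⁿ`. -/
abbrev Euc (n : ℕ) : Type := EuclideanSpace ℝ (Fin n)

/-- A bounded Lipschitz domain in `ℝⁿ`: a bounded connected (nonempty) open set which, near each of
its boundary points, is the region lying above the graph of a Lipschitz function, in suitable
orthogonal coordinates. The vertical direction is the unit vector `e`, and the graph is that of a
Lipschitz function on the hyperplane orthogonal to `e`. -/
structure IsBoundedLipschitzDomain {n : ℕ} (Ω : Set (Euc n)) : Prop where
  isOpen : IsOpen Ω
  isConnected : IsConnected Ω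
  isBounded : Bornology.IsBounded Ω
  exists_graph : ∀ x₀ ∈ frontier Ω, ∃ (ρ : ℝ) (e : Euc n) (K : NNReal)
    (γ : (Submodule.span ℝ {e})ᗮ → ℝ), 0 < ρ ∧ ‖e‖ = 1 ∧ LipschitzWith K γ ∧
      ∀ x ∈ Metric.ball x₀ ρ,
        (x ∈ Ω ↔ γ ((Submodule.span ℝ {e})ᗮ.orthogonalProjectionOnto x) < inner ℝ e x)

/-- The distance `δ(x)` to the boundary of `Ω`. -/
def bdist {n : ℕ} (Ω : Set (Euc n)) (x : Euc n) : ℝ := Metric.infDist x (frontier Ω)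

/-- The measure `δ(x)^a dx` on `Ω`. -/
def bdistMeasure {n : ℕ} (Ω : Set (Euc n)) (a : ℝ) : MeasureTheory.Measure (Euc n) :=
  (MeasureTheory.volume.restrict Ω).withDensity (fun x => ENNReal.ofReal (bdist Ω x ^ a))

/-- `u ∈ C_0^∞(Ω)`: smooth functions with compact support contained in `Ω`. -/
structure IsTestFunction {n : ℕ} (Ω : Set (Euc n)) (u : Euc n → ℝ) : Prop where
  contDiff : ContDiff ℝ ∞ u
  hasCompactSupport : HasCompactSupport u
  tsupport_subset : tsupport u ⊆ Ω

/-- The second partial derivative `∂_j ∂_i u` at `x`. -/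
def secondPartial {n : ℕ} (u : Euc n → ℝ) (i j : Fin n) (x : Euc n) : ℝ :=
  fderiv ℝ (fun y => fderiv ℝ u y (EuclideanSpace.single i 1)) x (EuclideanSpace.single j 1)

/-- The Euclidean (Frobenius) norm `|∇²u(x)|` of the matrix of second derivatives. -/
def hessNorm {n : ℕ} (u : Euc n → ℝ) (x : Euc n) : ℝ :=
  Real.sqrt (∑ i, ∑ j, secondPartial u i j x ^ 2)

/-- `N`-functions `M : [0,∞) → [0,∞)` (values at negative arguments are irrelevant). -/
structure IsNFunction (M : ℝ → ℝ) : Prop where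
  nonneg : ∀ t, 0 ≤ t → 0 ≤ M t
  continuousOn : ContinuousOn M (Set.Ici 0)
  convexOn : ConvexOn ℝ (Set.Ici 0) M
  tendsto_zero : Filter.Tendsto (fun t => M t / t) (nhdsWithin 0 (Set.Ioi 0)) (nhds 0)
  tendsto_atTop : Filter.Tendsto (fun t => M t / t) Filter.atTop Filter.atTop

/-- Condition (M): `M` is an `N`-function of class `C¹` on `(0,∞)`, it satisfies the
`Δ₂`-condition, and `M'(t)/t` is bounded near zero. -/
structure ConditionM (M : ℝ → ℝ) : Prop where
  isNFunction : IsNFunction M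
  contDiffOn : ContDiffOn ℝ 1 M (Set.Ioi 0)
  delta_two : ∃ D : ℝ, 0 < D ∧ ∀ t, 0 < t → M (2 * t) ≤ D * M t
  deriv_bound : ∃ C ε : ℝ, 0 < ε ∧ ∀ t, 0 < t → t < ε → |deriv M t / t| ≤ C

/-- The modular `∫ M(|f|) dμ`, with values in `[0,∞]`. -/
def modular {n : ℕ} (M : ℝ → ℝ) (μ : MeasureTheory.Measure (Euc n)) (f : Euc n → ℝ) : ℝ≥0∞ :=
  ∫⁻ x, ENNReal.ofReal (M |f x|) ∂μ

/-- The Luxemburg norm `inf {k > 0 : ∫ M(|f|/k) dμ ≤ 1}`, with values in `[0,∞]`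
(it is `∞` exactly when there is no such `k`). -/
def luxNorm {n : ℕ} (M : ℝ → ℝ) (μ : MeasureTheory.Measure (Euc n)) (f : Euc n → ℝ) : ℝ≥0∞ :=
  sInf {K : ℝ≥0∞ | ∃ k : ℝ, 0 < k ∧ K = ENNReal.ofReal k ∧ modular M μ (fun x => f x / k) ≤ 1}

end WeightedGN

end

/-!
# A weighted Gagliardo–Nirenberg inequality on bounded Lipschitz domains

Write `δ` for the distance to the boundary, `m(s) = M(s) / s²`, and `s` for the length of `∇u`,
regularized to `√(ε² + |∇u|²)`. Integrating by parts,
`∫ |∇u|² m(s) δ^a = -∫ u div(m(s) ∇u) δ^a - ∫ u m(s) ∇u · ∇(δ^a)`.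
Since `M` is doubling and convex, `s |m'(s)|` is at most a multiple of `m(s)`, so the right-hand side
is bounded by a multiple of `∫ m(s) |u| (|∇²u| + |∇u| / δ) δ^a`; here `δ` is only Lipschitz, and the
integration by parts is the one for Lipschitz functions provided by Rademacher's theorem
(`IsTestFunction.integral_partial_sq_mul_le`). The structural condition on `M` and `Q`, used with a
large multiple of `|∇²u| + |∇u| / δ` in the place of `v`, bounds the integrand by
`½ M(s) + C (|∇²u| + |∇u| / δ)^q + ½ Q(|u|)`. As `ε → 0`, the term `½ ∫ M(|∇u|) δ^a`, which is finite
by compactness of the support, is absorbed (`IsTestFunction.integral_modular_gradient_le`), and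
Hardy's inequality `∫ (|∇u| / δ)^q δ^a ≤ C ∫ |∇²u|^q δ^a` disposes of the remaining term
(`exists_modular_gradient_le`).

Hardy's inequality (`exists_hardy`), valid for `a < q - 1`, is proved locally. Near a boundary point,
the height `t` over the graph is comparable to `δ` and has derivative one in the vertical direction,
so that the one-dimensional argument, integrated over vertical lines, applies
(`hardy_along_direction`). As functions are integrated from the boundary, where they vanish, no
lower-order terms arise. In the interior the inequality spreads along the connected set `Ω` by
translation (`HardyOn.exists_nhds_of_ball`), and compactness of the closure finishes the proof.

The multiplicative inequalities follow by scaling: the condition on `M` and `Q` is unaffected if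
`(v, w)` is replaced by `(t v, w / t)`, and `u` can be multiplied by a constant. With both parameters
free, the two terms on the right can be normalized separately (`modular_gradient_div_sqrt_le`).
For powers, the condition on `M` and `Q` is Young's inequality with three exponents.
-/

namespace WeightedGN

open MeasureTheory Set Filter Topology

/-! ### The Hardy inequality in a chart -/

/-- Young's inequality in the form in which one side can be absorbed. -/
lemma mul_rpow_sub_one_mul_le {q κ y z : ℝ} (hq : 1 < q) (hκ : 0 < κ) (hy : 0 ≤ y) (hz : 0 ≤ z) :
    q * y ^ (q - 1) * z ≤ q * κ * y ^ q + q * κ ^ (1 - q) * z ^ q := by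
  have hq0 : 0 < q := by linarith
  rcases le_total z (κ * y) with h | h
  · have h1 : y ^ (q - 1) * y = y ^ q := by
      rcases hy.eq_or_lt with rfl | hy
      · rw [Real.zero_rpow hq0.ne', mul_zero]
      · rw [← Real.rpow_add_one hy.ne', sub_add_cancel]
    have h2 : y ^ (q - 1) * z ≤ y ^ (q - 1) * (κ * y) := by gcongr
    have h3 : 0 ≤ q * κ ^ (1 - q) * z ^ q := by positivity
    have h4 : q * (y ^ (q - 1) * z) ≤ q * (κ * (y ^ (q - 1) * y)) := by
      exact mul_le_mul_of_nonneg_left (by linarith) hq0.le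
    rw [h1] at h4
    linarith
  · have hyz : y ≤ z / κ := by rw [le_div_iff₀ hκ]; linarith
    have h2 : y ^ (q - 1) * z ≤ κ ^ (1 - q) * z ^ q := by
      calc y ^ (q - 1) * z ≤ (z / κ) ^ (q - 1) * z := by gcongr
        _ = κ ^ (1 - q) * (z ^ (q - 1) * z) := by
          rw [Real.div_rpow hz hκ.le, show (1 - q) = -(q - 1) by ring, Real.rpow_neg hκ.le]
          field_simp
        _ = κ ^ (1 - q) * z ^ q := by
          congr 1
          rcases hz.eq_or_lt with rfl | hz
          · rw [Real.zero_rpow hq0.ne', mul_zero]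
          · rw [← Real.rpow_add_one hz.ne', sub_add_cancel]
    have h3 : 0 ≤ q * κ * y ^ q := by positivity
    nlinarith

lemma abs_deriv_abs_rpow {q : ℝ} (hq : 1 < q) (y : ℝ) :
    |deriv (fun y : ℝ => |y| ^ q) y| = q * |y| ^ (q - 1) := by
  rw [(hasDerivAt_abs_rpow y hq).deriv]
  have hq0 : 0 < q := by linarith
  rcases eq_or_ne y 0 with rfl | hy
  · simp [Real.zero_rpow (sub_pos.2 hq).ne']
  · have := abs_pos.2 hy
    rw [abs_mul, abs_mul, abs_of_pos hq0, abs_of_nonneg (by positivity), mul_assoc,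
      ← Real.rpow_add_one this.ne']
    congr 2; ring

lemma contDiff_abs_rpow {q : ℝ} (hq : 1 < q) : ContDiff ℝ 1 (fun y : ℝ => |y| ^ q) := by
  simpa using contDiff_norm_rpow (E := ℝ) hq

/-- A function with integrable line derivative in a given direction, integrable itself, has a line
derivative of vanishing integral. -/
lemma integral_eq_zero_of_hasLineDerivAt {n : ℕ} {h h' : Euc n → ℝ} {e : Euc n}
    (hh : Integrable h) (hh' : Integrable h') (hd : ∀ x, HasLineDerivAt ℝ h (h' x) x e) :
    ∫ x, h' x = 0 := by
  have := integral_bilinear_hasLineDerivAt_right_eq_neg_left_of_integrable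
    (μ := (volume : Measure (Euc n))) (f := fun _ => (1 : ℝ)) (f' := fun _ => (0 : ℝ))
    (g := h) (g' := h') (v := e) (B := ContinuousLinearMap.mul ℝ ℝ)
    (by simp) (by simpa using hh') (by simpa using hh)
    (fun x _ => by simpa [HasLineDerivAt] using hasDerivAt_const (0 : ℝ) (1 : ℝ)) (fun x _ => hd x)
  simpa using this

/-- **One-dimensional Hardy inequality, integrated over lines parallel to `e`.** The height function
`t` grows at unit speed along `e`, `A` is a union of such lines, and `f` vanishes on the part of `A`
of height between `-τ` and `0`. The cut-off `ψ` is nonincreasing in the height, so that the term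
containing its derivative has a favourable sign. -/
lemma hardy_along_direction {n : ℕ} {q a : ℝ} (hq : 1 < q) (ha : a < q - 1) :
    ∃ C : ℝ, 0 < C ∧ ∀ (e : Euc n) (t : Euc n → ℝ) (A : Set (Euc n)) (τ : ℝ) (ψ : ℝ → ℝ)
      (f : Euc n → ℝ), Continuous t → (∀ x s, t (x + s • e) = t x + s) → 0 < τ → IsClosed A →
      (∀ x (s : ℝ), x + s • e ∈ A ↔ x ∈ A) → ContDiff ℝ 1 ψ → Antitone ψ → (∀ s, 0 ≤ ψ s) →
      (∀ s, τ ≤ s → ψ s = 0) → ContDiff ℝ 1 f → HasCompactSupport f →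
      (∀ x ∈ tsupport f, x ∈ A → |t x| ≤ τ → 0 < t x) →
      ∫⁻ x in A ∩ {x | 0 < t x ∧ t x ≤ τ}, ENNReal.ofReal (ψ (t x) * (|f x| ^ q * t x ^ (a - q))) ≤
        ENNReal.ofReal C * ∫⁻ x in A ∩ {x | 0 < t x ∧ t x ≤ τ},
          ENNReal.ofReal (ψ (t x) * (|fderiv ℝ f x e| ^ q * t x ^ a)) := by
  have hq0 : 0 < q := by linarith
  set b : ℝ := q - 1 - a with hb
  have hb0 : 0 < b := by rw [hb]; linarith
  set κ : ℝ := b / (2 * q) with hκ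
  have hκ0 : 0 < κ := by positivity
  have hκb : q * κ = b / 2 := by rw [hκ]; field_simp
  set C₁ : ℝ := q * κ ^ (1 - q) with hC₁
  have hC₁0 : 0 < C₁ := by positivity
  refine ⟨2 / b * C₁, by positivity, ?_⟩
  intro e t A τ ψ f ht hte hτ hA hAe hψ hψa hψ0 hψτ hf hfc hpos
  set φ : ℝ → ℝ := fun y => |y| ^ q with hφ
  have hφ1 : ContDiff ℝ 1 φ := contDiff_abs_rpow hq
  have hφ0 : φ 0 = 0 := by simp [hφ, Real.zero_rpow hq0.ne']
  have hφ'0 : deriv φ 0 = 0 := by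
    have := abs_deriv_abs_rpow hq 0
    simpa [Real.zero_rpow (sub_pos.2 hq).ne'] using this
  have hψ' : ∀ s, deriv ψ s ≤ 0 := fun s => hψa.deriv_nonpos
  have hψ'τ : ∀ s, τ < s → deriv ψ s = 0 := by
    intro s hs
    have : ψ =ᶠ[𝓝 s] fun _ => 0 := by
      filter_upwards [lt_mem_nhds hs] with y hy using hψτ y hy.le
    rw [this.deriv_eq]; simp
  have hK : IsCompact (tsupport f ∩ (A ∩ {x | |t x| ≤ τ})) :=
    hfc.isCompact.inter_right (hA.inter (isClosed_le ht.abs continuous_const))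
  set K := tsupport f ∩ (A ∩ {x | |t x| ≤ τ}) with hKdef
  have hKpos : ∀ x ∈ K, 0 < t x := fun x hx => hpos x hx.1 hx.2.1 hx.2.2
  have hKm : MeasurableSet K := hK.isClosed.measurableSet
  have htc : ∀ c : ℝ, ContinuousOn (fun x => t x ^ c) K := fun c =>
    ht.continuousOn.rpow_const fun x hx => Or.inl (hKpos x hx).ne'
  have hfe : Continuous (fun x => fderiv ℝ f x e) :=
    (hf.continuous_fderiv one_ne_zero).clm_apply continuous_const
  have hφf : Continuous (fun x => φ (f x)) := hφ1.continuous.comp hf.continuous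
  have hφ'f : Continuous (fun x => deriv φ (f x)) :=
    (hφ1.continuous_deriv le_rfl).comp hf.continuous
  have hψt : Continuous (fun x => ψ (t x)) := hψ.continuous.comp ht
  have hψ't : Continuous (fun x => deriv ψ (t x)) := (hψ.continuous_deriv le_rfl).comp ht
  -- the function to be differentiated along `e`, and its derivative
  set H₀ : Euc n → ℝ := fun x => ψ (t x) * (φ (f x) * t x ^ (-b)) with hH₀
  set H₁ : Euc n → ℝ := fun x => deriv ψ (t x) * (φ (f x) * t x ^ (-b)) +
    ψ (t x) * (deriv φ (f x) * fderiv ℝ f x e * t x ^ (-b) + φ (f x) * (-b * t x ^ (-b - 1)))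
    with hH₁
  set S : Set (Euc n) := {x | x ∈ A ∧ 0 < t x} with hS
  have hf0 : ∀ x, x ∉ tsupport f → f x = 0 := fun x hx => image_eq_zero_of_notMem_tsupport hx
  have hH₀K : ∀ x ∈ S, x ∉ K → H₀ x = 0 := by
    intro x ⟨hxA, hxt⟩ hx
    by_cases hxf : x ∈ tsupport f
    · have : τ ≤ t x := by
        by_contra! hlt
        exact hx ⟨hxf, hxA, (abs_of_pos hxt).trans_le hlt.le⟩
      simp [hH₀, hψτ _ this]
    · simp [hH₀, hf0 x hxf, hφ0]
  have hH₁K : ∀ x ∈ S, x ∉ K → H₁ x = 0 := by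
    intro x ⟨hxA, hxt⟩ hx
    by_cases hxf : x ∈ tsupport f
    · have : τ < t x := by
        by_contra! hlt
        exact hx ⟨hxf, hxA, (abs_of_pos hxt).trans_le hlt⟩
      simp [hH₁, hψτ _ this.le, hψ'τ _ this]
    · simp [hH₁, hf0 x hxf, hφ0, hφ'0]
  have hind : ∀ F : Euc n → ℝ, ContinuousOn F K → (∀ x ∈ S, x ∉ K → F x = 0) →
      Integrable (S.indicator F) ∧ ∫ x, S.indicator F x = ∫ x in K, F x := by
    intro F hF hFK
    have h1 : S.indicator F = K.indicator F := by
      ext x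
      by_cases hxS : x ∈ S
      · by_cases hxK : x ∈ K
        · simp [hxS, hxK]
        · simp [hxS, hxK, hFK x hxS hxK]
      · have : x ∉ K := fun h => hxS ⟨h.2.1, hKpos x h⟩
        simp [hxS, this]
    rw [h1, integrable_indicator_iff hKm, integral_indicator hKm]
    exact ⟨hF.integrableOn_compact hK, rfl⟩
  have hH₀c : ContinuousOn H₀ K := hψt.continuousOn.mul (hφf.continuousOn.mul (htc _))
  have hH₁c : ContinuousOn H₁ K :=
    (hψ't.continuousOn.mul (hφf.continuousOn.mul (htc _))).add
      (hψt.continuousOn.mul (((hφ'f.mul hfe).continuousOn.mul (htc _)).add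
        (hφf.continuousOn.mul (continuousOn_const.mul (htc _)))))
  have hline : ∀ x, HasLineDerivAt ℝ (S.indicator H₀) (S.indicator H₁ x) x e := by
    intro x
    unfold HasLineDerivAt
    have hc : Continuous (fun s : ℝ => x + s • e) := by fun_prop
    have hx00 : x + (0 : ℝ) • e = x := by simp
    have hx0 : t (x + (0 : ℝ) • e) = t x := by simp
    have hpre : ∀ U ∈ 𝓝 x, ∀ᶠ s : ℝ in 𝓝 0, x + s • e ∈ U := fun U hU =>
      hc.continuousAt.preimage_mem_nhds (by rwa [hx00])
    have hvan : x ∉ S → (∀ᶠ s : ℝ in 𝓝 0, S.indicator H₀ (x + s • e) = 0) →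
        HasDerivAt (fun s : ℝ => S.indicator H₀ (x + s • e)) (S.indicator H₁ x) 0 := by
      intro hxS hev
      rw [indicator_of_notMem hxS]
      exact (hasDerivAt_const (0 : ℝ) (0 : ℝ)).congr_of_eventuallyEq hev
    by_cases hxA : x ∈ A
    · rcases lt_trichotomy (t x) 0 with hxt | hxt | hxt
      · refine hvan (fun h => hxt.not_gt h.2) ?_
        filter_upwards [hpre _ ((isOpen_lt ht continuous_const).mem_nhds hxt)] with s hs
        exact indicator_of_notMem (fun h => h.2.not_gt hs) _
      · have hxf : x ∉ tsupport f := fun hxf =>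
          hxt.not_gt (hpos x hxf hxA (by rw [hxt, abs_zero]; exact hτ.le))
        refine hvan (fun h => hxt.not_gt h.2) ?_
        filter_upwards [hpre _ ((isClosed_tsupport f).isOpen_compl.mem_nhds hxf)] with s hs
        refine indicator_apply_eq_zero.2 fun _ => ?_
        simp [hH₀, hf0 _ hs, hφ0]
      · rw [indicator_of_mem (show x ∈ S from ⟨hxA, hxt⟩)]
        have hev : (fun s : ℝ => S.indicator H₀ (x + s • e)) =ᶠ[𝓝 0] fun s => H₀ (x + s • e) := by
          filter_upwards [hpre _ ((isOpen_lt continuous_const ht).mem_nhds hxt)] with s hs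
          exact indicator_of_mem (show x + s • e ∈ S from ⟨(hAe x s).2 hxA, hs⟩) _
        refine HasDerivAt.congr_of_eventuallyEq ?_ hev
        have d1 : HasDerivAt (fun s : ℝ => t (x + s • e)) 1 0 := by
          simp only [hte]; simpa using (hasDerivAt_id (0 : ℝ)).const_add (t x)
        have d2 : HasDerivAt (fun s : ℝ => ψ (t (x + s • e))) (deriv ψ (t x)) 0 := by
          have h := (hψ.differentiable one_ne_zero (t x)).hasDerivAt
          rw [← hx0] at h
          simpa [hx0, Function.comp_def] using h.comp (0 : ℝ) d1
        have d3 : HasDerivAt (fun s : ℝ => f (x + s • e)) (fderiv ℝ f x e) 0 := by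
          simpa [HasLineDerivAt] using
            ((hf.differentiable one_ne_zero x).hasFDerivAt.hasLineDerivAt e)
        have d4 : HasDerivAt (fun s : ℝ => φ (f (x + s • e)))
            (deriv φ (f x) * fderiv ℝ f x e) 0 := by
          have h := (hφ1.differentiable one_ne_zero (f x)).hasDerivAt
          have hx1 : f (x + (0 : ℝ) • e) = f x := by simp
          rw [← hx1] at h
          simpa [hx1, Function.comp_def] using h.comp (0 : ℝ) d3
        have d5 : HasDerivAt (fun s : ℝ => t (x + s • e) ^ (-b)) (-b * t x ^ (-b - 1)) 0 := by
          have := d1.rpow_const (p := -b) (Or.inl (by rw [hx0]; exact hxt.ne'))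
          simpa [hx0] using this
        have d6 := d2.fun_mul (d4.fun_mul d5)
        simp only [zero_smul, add_zero] at d6
        exact d6
    · refine hvan (fun h => hxA h.1) (.of_forall fun s => ?_)
      exact indicator_of_notMem (fun h => hxA ((hAe x s).1 h.1)) _
  obtain ⟨hi0, -⟩ := hind H₀ hH₀c hH₀K
  obtain ⟨hi1, he1⟩ := hind H₁ hH₁c hH₁K
  have hzero : ∫ x in K, H₁ x = 0 := by
    rw [← he1]; exact integral_eq_zero_of_hasLineDerivAt hi0 hi1 hline
  set F : Euc n → ℝ := fun x => ψ (t x) * (|f x| ^ q * t x ^ (a - q)) with hF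
  set G : Euc n → ℝ := fun x => ψ (t x) * (|fderiv ℝ f x e| ^ q * t x ^ a) with hG
  have hFc : ContinuousOn F K := hψt.continuousOn.mul (hφf.continuousOn.mul (htc _))
  have hGc : ContinuousOn G K := hψt.continuousOn.mul
    ((hfe.abs.rpow_const fun _ => Or.inr hq0.le).continuousOn.mul (htc _))
  have hFi := hFc.integrableOn_compact hK (μ := volume)
  have hGi := hGc.integrableOn_compact hK (μ := volume)
  have hpt : ∀ x ∈ K, H₁ x ≤ -(b / 2) * F x + C₁ * G x := by
    intro x hx
    have htx := hKpos x hx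
    have hψx := hψ0 (t x)
    have e1 : t x ^ (-b) = t x ^ (a - q) * t x := by
      rw [← Real.rpow_add_one htx.ne']; congr 1; rw [hb]; ring
    have e2 : t x ^ (-b - 1) = t x ^ (a - q) := by congr 1; rw [hb]; ring
    have e3 : t x ^ a = t x ^ (a - q) * t x ^ q := by
      rw [← Real.rpow_add htx]; congr 1; ring
    have hP : 0 ≤ t x ^ (a - q) := by positivity
    have hY := mul_rpow_sub_one_mul_le hq hκ0 (abs_nonneg (f x))
      (mul_nonneg htx.le (abs_nonneg (fderiv ℝ f x e)))
    rw [hκb, ← hC₁, Real.mul_rpow htx.le (abs_nonneg _)] at hY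
    have hD : deriv φ (f x) * fderiv ℝ f x e ≤ q * |f x| ^ (q - 1) * |fderiv ℝ f x e| := by
      rw [← abs_deriv_abs_rpow hq]
      exact (le_abs_self _).trans (abs_mul _ _).le
    have h1 : deriv ψ (t x) * (φ (f x) * t x ^ (-b)) ≤ 0 :=
      mul_nonpos_of_nonpos_of_nonneg (hψ' _) (by simp only [hφ]; positivity)
    have h2 : deriv φ (f x) * fderiv ℝ f x e * t x ≤
        b / 2 * |f x| ^ q + C₁ * (t x ^ q * |fderiv ℝ f x e| ^ q) := by
      nlinarith [mul_le_mul_of_nonneg_right hD htx.le]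
    have h3 := mul_le_mul_of_nonneg_left h2 (mul_nonneg hψx hP)
    simp only [hH₁, hF, hG, e1, e2, e3]
    simp only [hφ] at h1 h3 ⊢
    rw [e1] at h1
    linarith
  have hint : b / 2 * ∫ x in K, F x ≤ C₁ * ∫ x in K, G x := by
    have h := setIntegral_mono_on (hH₁c.integrableOn_compact hK)
      ((hFi.const_mul (-(b / 2))).add (hGi.const_mul C₁)) hKm hpt
    simp only [Pi.add_apply] at h
    rw [hzero, integral_add (hFi.const_mul _) (hGi.const_mul _), integral_const_mul,
      integral_const_mul] at h
    linarith
  have hKZ : K ⊆ A ∩ {x | 0 < t x ∧ t x ≤ τ} := fun x hx => ⟨hx.2.1, hKpos x hx, (le_abs_self _).trans hx.2.2⟩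
  have hFnn : ∀ x ∈ K, 0 ≤ F x := fun x hx => by
    have := hKpos x hx; have := hψ0 (t x); simp only [hF]; positivity
  have hGnn : ∀ x ∈ K, 0 ≤ G x := fun x hx => by
    have := hKpos x hx; have := hψ0 (t x); simp only [hG]; positivity
  have hZm : MeasurableSet (A ∩ {x | 0 < t x ∧ t x ≤ τ}) :=
    hA.measurableSet.inter ((measurableSet_lt measurable_const ht.measurable).inter
      (measurableSet_le ht.measurable measurable_const))
  calc ∫⁻ x in A ∩ {x | 0 < t x ∧ t x ≤ τ}, ENNReal.ofReal (F x)
      ≤ ∫⁻ x in K, ENNReal.ofReal (F x) := by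
        rw [← lintegral_indicator hZm, ← lintegral_indicator hKm]
        refine lintegral_mono fun x => ?_
        by_cases hxK : x ∈ K
        · rw [indicator_of_mem hxK, indicator_of_mem (hKZ hxK)]
        · rw [indicator_of_notMem hxK]
          by_cases hxZ : x ∈ A ∩ {x | 0 < t x ∧ t x ≤ τ}
          · have : f x = 0 := hf0 x fun h => hxK ⟨h, hxZ.1, (abs_of_pos hxZ.2.1).trans_le hxZ.2.2⟩
            simp [hF, this, Real.zero_rpow hq0.ne']
          · rw [indicator_of_notMem hxZ]
    _ = ENNReal.ofReal (∫ x in K, F x) :=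
        (ofReal_integral_eq_lintegral_ofReal hFi ((ae_restrict_iff' hKm).2 (.of_forall hFnn))).symm
    _ ≤ ENNReal.ofReal (2 / b * C₁ * ∫ x in K, G x) := by
        apply ENNReal.ofReal_le_ofReal
        rw [mul_assoc, div_mul_eq_mul_div, le_div_iff₀ hb0]
        linarith
    _ = ENNReal.ofReal (2 / b * C₁) * ∫⁻ x in K, ENNReal.ofReal (G x) := by
        rw [ENNReal.ofReal_mul (by positivity), ofReal_integral_eq_lintegral_ofReal hGi
          ((ae_restrict_iff' hKm).2 (.of_forall hGnn))]
    _ ≤ _ := by gcongr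

/-! ### Hardy's inequality near a boundary point -/

/-- Hardy's inequality holds on the part of `Ω` that lies in `U`, with the full Dirichlet integral
over `Ω` on the right-hand side. -/
def HardyOn {n : ℕ} (Ω : Set (Euc n)) (q a : ℝ) (U : Set (Euc n)) : Prop :=
  ∃ C : ℝ, 0 < C ∧ ∀ f : Euc n → ℝ, IsTestFunction Ω f →
    ∫⁻ x in Ω ∩ U, ENNReal.ofReal (|f x| ^ q * bdist Ω x ^ (a - q)) ≤
      ENNReal.ofReal C * ∫⁻ x in Ω, ENNReal.ofReal (‖fderiv ℝ f x‖ ^ q * bdist Ω x ^ a)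

lemma continuous_bdist {n : ℕ} (Ω : Set (Euc n)) : Continuous (bdist Ω) :=
  Metric.continuous_infDist_pt _

lemma bdist_pos {n : ℕ} {Ω : Set (Euc n)} (hΩ : IsOpen Ω) (hne : (frontier Ω).Nonempty)
    {x : Euc n} (hx : x ∈ Ω) : 0 < bdist Ω x := by
  refine (isClosed_frontier.notMem_iff_infDist_pos hne).1 fun h => ?_
  rw [hΩ.frontier_eq] at h
  exact h.2 hx

lemma IsBoundedLipschitzDomain.frontier_nonempty {n : ℕ} (hn : 1 ≤ n) {Ω : Set (Euc n)}
    (hΩ : IsBoundedLipschitzDomain Ω) : (frontier Ω).Nonempty := by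
  have : Nonempty (Fin n) := ⟨⟨0, hn⟩⟩
  rw [nonempty_iff_ne_empty, Ne, ← isClopen_iff_frontier_eq_empty, isClopen_iff]
  rintro (h | h)
  · exact hΩ.isConnected.nonempty.ne_empty h
  · have hb := hΩ.isBounded
    rw [h] at hb
    exact NoncompactSpace.noncompact_univ
      (Metric.isCompact_of_isClosed_isBounded isClosed_univ hb)

/-- Comparable positive numbers have comparable powers, for exponents of either sign. -/
lemma rpow_le_rpow_abs_mul {s t L c : ℝ} (hs : 0 < s) (ht : 0 < t) (hL : 1 ≤ L) (hst : s ≤ L * t)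
    (hts : t ≤ L * s) : s ^ c ≤ L ^ |c| * t ^ c := by
  have hL0 : 0 < L := by linarith
  rcases le_total 0 c with hc | hc
  · rw [abs_of_nonneg hc, ← Real.mul_rpow hL0.le ht.le]
    exact Real.rpow_le_rpow hs.le hst hc
  · rw [abs_of_nonpos hc]
    have h1 : t / L ≤ s := by rw [div_le_iff₀ hL0]; linarith
    calc s ^ c ≤ (t / L) ^ c := Real.rpow_le_rpow_of_nonpos (by positivity) h1 hc
      _ = L ^ (-c) * t ^ c := by
        rw [Real.div_rpow ht.le hL0.le, Real.rpow_neg hL0.le]; field_simp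

/-- Near a boundary point of a Lipschitz domain there is a height function `t`, growing at unit
speed in a direction `e`, which is positive exactly in `Ω` and is comparable to the distance to the
boundary. The set `A` is a closed cylinder with axis `e`. -/
lemma IsBoundedLipschitzDomain.exists_height {n : ℕ} {Ω : Set (Euc n)}
    (hΩ : IsBoundedLipschitzDomain Ω) {x₀ : Euc n} (hx₀ : x₀ ∈ frontier Ω) :
    ∃ (e : Euc n) (t : Euc n → ℝ) (A : Set (Euc n)) (τ L : ℝ), ‖e‖ = 1 ∧ Continuous t ∧
      (∀ x s, t (x + s • e) = t x + s) ∧ IsClosed A ∧ (∀ x (s : ℝ), x + s • e ∈ A ↔ x ∈ A) ∧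
      A ∈ 𝓝 x₀ ∧ 0 < τ ∧ 1 ≤ L ∧ t x₀ = 0 ∧
      ∀ x ∈ A, |t x| ≤ τ → (x ∈ Ω ↔ 0 < t x) ∧
        (0 < t x → bdist Ω x ≤ L * t x ∧ t x ≤ L * bdist Ω x) := by
  obtain ⟨ρ, e, K, γ, hρ, he, hγ, hiff⟩ := hΩ.exists_graph x₀ hx₀
  set P := (Submodule.span ℝ {e})ᗮ.orthogonalProjectionOnto with hP
  set t : Euc n → ℝ := fun x => inner ℝ e x - γ (P x) with ht
  have hPe : P e = 0 := Submodule.orthogonalProjectionOnto_orthogonalComplement_singleton_eq_zero e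
  have hPl : ∀ x (s : ℝ), P (x + s • e) = P x := fun x s => by
    rw [map_add, map_smul, hPe, smul_zero, add_zero]
  have htl : ∀ x s, t (x + s • e) = t x + s := fun x s => by
    simp only [ht]
    rw [hPl, inner_add_right, inner_smul_right, real_inner_self_eq_norm_sq, he]
    ring
  have htc : Continuous t := by
    have := hγ.continuous
    simp only [ht]; fun_prop
  have hPn : ∀ x y, dist (P x) (P y) ≤ dist x y := fun x y => by
    rw [dist_eq_norm, dist_eq_norm, ← map_sub]
    exact Submodule.norm_orthogonalProjectionOnto_apply_le _ _
  have hγP : ∀ x y, |γ (P x) - γ (P y)| ≤ K * dist (P x) (P y) := fun x y => by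
    have := hγ.dist_le_mul (P x) (P y)
    rwa [Real.dist_eq] at this
  have htL : ∀ x y, |t x - t y| ≤ (1 + K) * dist x y := by
    intro x y
    have h1 : |inner ℝ e x - inner ℝ e y| ≤ dist x y := by
      rw [← inner_sub_right, dist_eq_norm]
      simpa [he] using abs_real_inner_le_norm e (x - y)
    have h2 := (hγP x y).trans (mul_le_mul_of_nonneg_left (hPn x y) K.2)
    have h3 : t x - t y = (inner ℝ e x - inner ℝ e y) - (γ (P x) - γ (P y)) := by
      simp only [ht]; ring
    rw [h3]
    refine (abs_sub _ _).trans ?_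
    linarith
  have hiff' : ∀ x ∈ Metric.ball x₀ ρ, (x ∈ Ω ↔ 0 < t x) := fun x hx => by
    rw [hiff x hx]; simp only [ht]; exact sub_pos.symm
  have hfr : ∀ y ∈ Metric.ball x₀ ρ, y ∈ frontier Ω → t y = 0 := by
    intro y hy hyf
    rw [hΩ.isOpen.frontier_eq] at hyf
    have h1 : t y ≤ 0 := not_lt.1 fun h => hyf.2 ((hiff' y hy).2 h)
    refine le_antisymm h1 (not_lt.1 fun h => ?_)
    obtain ⟨z, ⟨hz1, hz2⟩, hz3⟩ := mem_closure_iff.1 hyf.1 _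
      ((isOpen_lt htc continuous_const).inter Metric.isOpen_ball) ⟨h, hy⟩
    exact lt_asymm ((hiff' z hz2).1 hz3) hz1
  have hfr' : ∀ y ∈ Metric.ball x₀ ρ, t y = 0 → y ∈ frontier Ω := by
    intro y hy hy0
    rw [hΩ.isOpen.frontier_eq]
    refine ⟨mem_closure_iff_nhds.2 fun U hU => ?_, fun h => ((hiff' y hy).1 h).ne' hy0⟩
    have hc : Continuous (fun s : ℝ => y + s • e) := by fun_prop
    have : ∀ᶠ s : ℝ in 𝓝[>] 0, y + s • e ∈ U ∩ Metric.ball x₀ ρ := by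
      refine nhdsWithin_le_nhds (hc.continuousAt.preimage_mem_nhds ?_)
      rw [zero_smul, add_zero]
      exact inter_mem hU (Metric.isOpen_ball.mem_nhds hy)
    obtain ⟨s, hs, hs0⟩ := (this.and self_mem_nhdsWithin).exists
    exact ⟨y + s • e, hs.1, (hiff' _ hs.2).2 (by rw [htl, hy0, zero_add]; exact hs0)⟩
  have htx₀ : t x₀ = 0 := hfr x₀ (Metric.mem_ball_self hρ) hx₀
  have hK0 : (0 : ℝ) ≤ K := K.2
  set σ : ℝ := ρ / (4 * (K + 3)) with hσ
  have hσ0 : 0 < σ := by positivity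
  have hσρ : σ * (K + 3) = ρ / 4 := by rw [hσ]; field_simp
  have hball : ∀ x, dist (P x) (P x₀) ≤ σ → |t x| ≤ σ → dist x x₀ < ρ / 4 := by
    intro x hx1 hx2
    have h1 : |inner ℝ e (x - x₀)| ≤ (1 + K) * σ := by
      have : inner ℝ e (x - x₀) = t x + (γ (P x) - γ (P x₀)) := by
        have h0 : inner ℝ e x₀ - γ (P x₀) = 0 := htx₀
        rw [inner_sub_right]; simp only [ht]; linarith
      rw [this]
      refine (abs_add_le _ _).trans ?_
      have := (hγP x x₀).trans (mul_le_mul_of_nonneg_left hx1 hK0)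
      linarith
    have h2 := Submodule.starProjection_add_starProjection_orthogonal
      (K := Submodule.span ℝ {e}) (x - x₀)
    rw [Submodule.starProjection_unit_singleton ℝ he, Submodule.starProjection_apply] at h2
    rw [dist_eq_norm, ← h2]
    refine (norm_add_le _ _).trans_lt ?_
    rw [norm_smul, he, mul_one, Real.norm_eq_abs]
    have h3 : ‖((P (x - x₀) : (Submodule.span ℝ {e})ᗮ) : Euc n)‖ ≤ σ := by
      have : ‖P (x - x₀)‖ ≤ σ := by rw [map_sub, ← dist_eq_norm]; exact hx1
      exact this
    have h4 : (1 + K) * σ + σ < ρ / 4 := by rw [← hσρ]; nlinarith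
    linarith
  have hPc : Continuous fun x => dist (P x) (P x₀) := by fun_prop
  refine ⟨e, t, {x | dist (P x) (P x₀) ≤ σ}, σ, 1 + K, he, htc, htl,
    isClosed_le hPc continuous_const, fun x s => by simp only [mem_ofPred_eq, hPl], ?_, hσ0,
    by linarith, htx₀, ?_⟩
  · refine mem_of_superset ((isOpen_lt hPc continuous_const).mem_nhds ?_) fun x (hx : dist (P x) (P x₀) < σ) => hx.le
    simpa using hσ0
  · intro x hxA hxt
    have hx4 := hball x hxA hxt
    have hxb : x ∈ Metric.ball x₀ ρ := Metric.mem_ball.2 (by linarith)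
    refine ⟨hiff' x hxb, fun hpos => ⟨?_, ?_⟩⟩
    · -- the point of the graph below `x` belongs to the boundary
      have h1 : x + (-t x) • e ∈ frontier Ω := by
        refine hfr' _ ?_ (by rw [htl]; ring)
        rw [Metric.mem_ball]
        have h2 : dist (x + (-t x) • e) x = |t x| := by
          rw [dist_eq_norm, add_sub_cancel_left, norm_smul, he]; simp
        have h3 : σ ≤ ρ / 4 := by rw [← hσρ]; nlinarith
        linarith [dist_triangle (x + (-t x) • e) x x₀]
      have h2 : bdist Ω x ≤ dist x (x + (-t x) • e) := Metric.infDist_le_dist_of_mem h1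
      have h3 : dist x (x + (-t x) • e) = t x := by
        rw [dist_comm, dist_eq_norm, add_sub_cancel_left, norm_smul, he]; simp [hpos.le]
      nlinarith
    · obtain ⟨y, hyf, hy⟩ := isClosed_frontier.exists_infDist_eq_dist ⟨x₀, hx₀⟩ x
      have h1 : dist x y ≤ dist x x₀ := hy ▸ Metric.infDist_le_dist_of_mem hx₀
      have h2 : y ∈ Metric.ball x₀ ρ := by
        rw [Metric.mem_ball]
        have := dist_triangle y x x₀
        rw [dist_comm y x] at this
        linarith
      have h3 := htL x y
      rw [hfr y h2 hyf, sub_zero, abs_of_pos hpos, ← hy] at h3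
      exact h3

lemma hardyOn_nhds_frontier {n : ℕ} {Ω : Set (Euc n)}
    (hΩ : IsBoundedLipschitzDomain Ω) {q a : ℝ} (hq : 1 < q) (ha : a < q - 1) {x₀ : Euc n}
    (hx₀ : x₀ ∈ frontier Ω) : ∃ U ∈ 𝓝 x₀, HardyOn Ω q a U := by
  obtain ⟨e, t, A, τ, L, he, htc, htl, hA, hAe, hA₀, hτ, hL, ht₀, hcomp⟩ := hΩ.exists_height hx₀
  obtain ⟨C, hC, hC'⟩ := hardy_along_direction (n := n) hq ha
  have hq0 : 0 < q := by linarith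
  have hL0 : 0 < L := by linarith
  set ψ : ℝ → ℝ := fun s => Real.smoothTransition (2 - 2 * s / τ) with hψ
  have hψc : ContDiff ℝ 1 ψ :=
    (Real.smoothTransition.contDiff (n := 1)).comp (by fun_prop)
  have hψa : Antitone ψ := fun s s' h => Real.smoothTransition.monotone (by gcongr)
  have hψτ : ∀ s, τ ≤ s → ψ s = 0 := fun s hs => Real.smoothTransition.zero_of_nonpos (by
    have : 1 ≤ s / τ := by rwa [one_le_div hτ]
    rw [mul_div_assoc]; linarith)
  have hψ1 : ∀ s, s ≤ τ / 2 → ψ s = 1 := fun s hs => Real.smoothTransition.one_of_one_le (by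
    have : s / τ ≤ 1 / 2 := by rw [div_le_iff₀ hτ]; linarith
    rw [mul_div_assoc]; linarith)
  have hfrne : (frontier Ω).Nonempty := ⟨x₀, hx₀⟩
  set Z := A ∩ {x | 0 < t x ∧ t x ≤ τ} with hZ
  have hZΩ : Z ⊆ Ω := fun x hx =>
    (hcomp x hx.1 ((abs_of_pos hx.2.1).trans_le hx.2.2)).1.2 hx.2.1
  have hZm : MeasurableSet Z :=
    hA.measurableSet.inter ((measurableSet_lt measurable_const htc.measurable).inter
      (measurableSet_le htc.measurable measurable_const))
  have hw : ∀ x ∈ Z, 0 < bdist Ω x ∧ bdist Ω x ≤ L * t x ∧ t x ≤ L * bdist Ω x := fun x hx =>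
    ⟨bdist_pos hΩ.isOpen hfrne (hZΩ hx), (hcomp x hx.1 ((abs_of_pos hx.2.1).trans_le hx.2.2)).2
      hx.2.1⟩
  refine ⟨A ∩ {x | |t x| < τ / 2}, inter_mem hA₀ ((isOpen_lt htc.abs continuous_const).mem_nhds
    (by simpa [ht₀] using hτ)), L ^ |a - q| * (C * L ^ |a|), by positivity, fun f hf => ?_⟩
  have hmain := hC' e t A τ ψ f htc htl hτ hA hAe hψc hψa
    (fun s => Real.smoothTransition.nonneg _) hψτ (hf.contDiff.of_le (by norm_cast))
    hf.hasCompactSupport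
    (fun x hx hxA hxt => (hcomp x hxA hxt).1.1 (hf.tsupport_subset hx))
  have hVZ : Ω ∩ (A ∩ {x | |t x| < τ / 2}) ⊆ A ∩ {x | 0 < t x ∧ t x ≤ τ / 2} := by
    rintro x ⟨hxΩ, hxA, hxt⟩
    have hxt' : |t x| < τ / 2 := hxt
    exact ⟨hxA, (hcomp x hxA (by linarith)).1.1 hxΩ, ((le_abs_self _).trans_lt hxt').le⟩
  have hVm : MeasurableSet (Ω ∩ (A ∩ {x | |t x| < τ / 2})) :=
    hΩ.isOpen.measurableSet.inter (hA.measurableSet.inter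
      (isOpen_lt htc.abs continuous_const).measurableSet)
  calc ∫⁻ x in Ω ∩ (A ∩ {x | |t x| < τ / 2}), ENNReal.ofReal (|f x| ^ q * bdist Ω x ^ (a - q))
      ≤ ∫⁻ x in Ω ∩ (A ∩ {x | |t x| < τ / 2}), ENNReal.ofReal (L ^ |a - q|) *
          ENNReal.ofReal (ψ (t x) * (|f x| ^ q * t x ^ (a - q))) := by
        refine setLIntegral_mono' hVm fun x hx => ?_
        obtain ⟨hxA, hx0, hx1⟩ := hVZ hx
        obtain ⟨h1, h2, h3⟩ := hw x ⟨hxA, hx0, by linarith⟩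
        rw [← ENNReal.ofReal_mul (by positivity), hψ1 _ hx1, one_mul]
        apply ENNReal.ofReal_le_ofReal
        have := rpow_le_rpow_abs_mul (c := a - q) h1 hx0 hL h2 h3
        calc |f x| ^ q * bdist Ω x ^ (a - q) ≤ |f x| ^ q * (L ^ |a - q| * t x ^ (a - q)) := by
              gcongr
          _ = _ := by ring
    _ = ENNReal.ofReal (L ^ |a - q|) * ∫⁻ x in Ω ∩ (A ∩ {x | |t x| < τ / 2}),
          ENNReal.ofReal (ψ (t x) * (|f x| ^ q * t x ^ (a - q))) :=
        lintegral_const_mul' _ _ ENNReal.ofReal_ne_top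
    _ ≤ ENNReal.ofReal (L ^ |a - q|) * (ENNReal.ofReal C * ∫⁻ x in Z,
          ENNReal.ofReal (ψ (t x) * (|fderiv ℝ f x e| ^ q * t x ^ a))) := by
        gcongr
        refine (lintegral_mono_set ?_).trans hmain
        exact hVZ.trans fun x hx => ⟨hx.1, hx.2.1, by linarith [hx.2.2]⟩
    _ ≤ ENNReal.ofReal (L ^ |a - q|) * (ENNReal.ofReal C * ∫⁻ x in Z, ENNReal.ofReal (L ^ |a|) *
          ENNReal.ofReal (‖fderiv ℝ f x‖ ^ q * bdist Ω x ^ a)) := by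
        gcongr ENNReal.ofReal (L ^ |a - q|) * (ENNReal.ofReal C * ?_)
        refine setLIntegral_mono' hZm fun x hx => ?_
        obtain ⟨h1, h2, h3⟩ := hw x hx
        rw [← ENNReal.ofReal_mul (by positivity)]
        apply ENNReal.ofReal_le_ofReal
        have hx0 : 0 < t x := hx.2.1
        have h4 := rpow_le_rpow_abs_mul (c := a) hx0 h1 hL h3 h2
        have h5 : |fderiv ℝ f x e| ≤ ‖fderiv ℝ f x‖ := by
          simpa [he] using (fderiv ℝ f x).le_opNorm e
        have h6 : ψ (t x) ≤ 1 := Real.smoothTransition.le_one _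
        calc ψ (t x) * (|fderiv ℝ f x e| ^ q * t x ^ a)
            ≤ 1 * (‖fderiv ℝ f x‖ ^ q * (L ^ |a| * bdist Ω x ^ a)) := by gcongr
          _ = _ := by ring
    _ = ENNReal.ofReal (L ^ |a - q|) * (ENNReal.ofReal C * (ENNReal.ofReal (L ^ |a|) *
          ∫⁻ x in Z, ENNReal.ofReal (‖fderiv ℝ f x‖ ^ q * bdist Ω x ^ a))) := by
        rw [lintegral_const_mul' _ _ ENNReal.ofReal_ne_top]
    _ ≤ ENNReal.ofReal (L ^ |a - q|) * (ENNReal.ofReal C * (ENNReal.ofReal (L ^ |a|) *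
          ∫⁻ x in Ω, ENNReal.ofReal (‖fderiv ℝ f x‖ ^ q * bdist Ω x ^ a))) := by
        gcongr
    _ = _ := by
        rw [ENNReal.ofReal_mul (by positivity), ENNReal.ofReal_mul hC.le]
        ring

/-! ### Hardy's inequality in the interior and on the whole domain -/

/-- The fundamental theorem of calculus along a segment, combined with Jensen's inequality. -/
lemma abs_rpow_le_translate_add {n : ℕ} {q : ℝ} (hq : 1 < q) {f : Euc n → ℝ} (hf : ContDiff ℝ 1 f)
    (w v : Euc n) :
    ENNReal.ofReal (|f w| ^ q) ≤ ENNReal.ofReal (2 ^ (q - 1)) * (ENNReal.ofReal (|f (w + v)| ^ q) +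
      ∫⁻ s in Icc (0 : ℝ) 1, ENNReal.ofReal (‖v‖ ^ q * ‖fderiv ℝ f (w + s • v)‖ ^ q)) := by
  have hq0 : 0 < q := by linarith
  have hcont : Continuous fun s : ℝ => fderiv ℝ f (w + s • v) :=
    (hf.continuous_fderiv one_ne_zero).comp (by fun_prop)
  have hcv : Continuous fun s : ℝ => fderiv ℝ f (w + s • v) v := hcont.clm_apply continuous_const
  set g : ℝ → ℝ := fun s => ‖v‖ * ‖fderiv ℝ f (w + s • v)‖ with hg
  have hgc : Continuous g := by fun_prop
  have hg0 : ∀ s, 0 ≤ g s := fun s => by positivity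
  have hftc : f (w + v) - f w = ∫ s in (0 : ℝ)..1, fderiv ℝ f (w + s • v) v := by
    rw [intervalIntegral.integral_eq_sub_of_hasDerivAt (f := fun s : ℝ => f (w + s • v))]
    · simp
    · intro s _
      have h1 : HasDerivAt (fun s : ℝ => w + s • v) v s := by
        simpa using ((hasDerivAt_id s).smul_const v).const_add w
      exact (hf.differentiable one_ne_zero (w + s • v)).hasFDerivAt.comp_hasDerivAt s h1
    · exact hcv.intervalIntegrable _ _
  rw [intervalIntegral.integral_of_le zero_le_one, ← integral_Icc_eq_integral_Ioc] at hftc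
  have : IsProbabilityMeasure (volume.restrict (Icc (0 : ℝ) 1)) := ⟨by simp⟩
  have hgi : IntegrableOn g (Icc 0 1) := hgc.continuousOn.integrableOn_compact isCompact_Icc
  have hgq : Continuous fun s => g s ^ q := hgc.rpow_const fun _ => Or.inr hq0.le
  have hgqi : IntegrableOn (fun s => g s ^ q) (Icc 0 1) :=
    hgq.continuousOn.integrableOn_compact isCompact_Icc
  have hle : |f (w + v) - f w| ≤ ∫ s in Icc (0 : ℝ) 1, g s := by
    rw [hftc, ← Real.norm_eq_abs]
    refine norm_integral_le_of_norm_le hgi (.of_forall fun s => ?_)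
    simp only [hg]
    rw [mul_comm]
    exact (fderiv ℝ f (w + s • v)).le_opNorm v
  have hjensen : (∫ s in Icc (0 : ℝ) 1, g s) ^ q ≤ ∫ s in Icc (0 : ℝ) 1, g s ^ q :=
    (convexOn_rpow hq.le).map_integral_le
      (continuousOn_id.rpow_const fun _ _ => Or.inr hq0.le) isClosed_Ici
      (.of_forall hg0) hgi hgqi
  have htri : |f w| ≤ |f (w + v)| + |f (w + v) - f w| := by
    have := abs_sub (f (w + v)) (f (w + v) - f w)
    simpa using this
  have hsum : |f w| ^ q ≤ 2 ^ (q - 1) * (|f (w + v)| ^ q + |f (w + v) - f w| ^ q) := by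
    refine (Real.rpow_le_rpow (abs_nonneg _) htri hq0.le).trans ?_
    exact_mod_cast NNReal.rpow_add_le_mul_rpow_add_rpow ⟨|f (w + v)|, abs_nonneg _⟩
      ⟨|f (w + v) - f w|, abs_nonneg _⟩ hq.le
  have hfin : |f w| ^ q ≤ 2 ^ (q - 1) * (|f (w + v)| ^ q + ∫ s in Icc (0 : ℝ) 1, g s ^ q) := by
    refine hsum.trans ?_
    gcongr
    exact (Real.rpow_le_rpow (abs_nonneg _) hle hq0.le).trans hjensen
  have hnn : 0 ≤ ∫ s in Icc (0 : ℝ) 1, g s ^ q := integral_nonneg fun s => by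
    have := hg0 s; positivity
  refine (ENNReal.ofReal_le_ofReal hfin).trans_eq ?_
  rw [ENNReal.ofReal_mul (by positivity), ENNReal.ofReal_add (by positivity) hnn,
    ofReal_integral_eq_lintegral_ofReal hgqi (.of_forall fun s => by have := hg0 s; positivity)]
  simp only [hg, Real.mul_rpow (norm_nonneg _) (norm_nonneg _)]

lemma lintegral_abs_rpow_le_translate_add {n : ℕ} {q : ℝ} (hq : 1 < q) {f : Euc n → ℝ}
    (hf : ContDiff ℝ 1 f) {v : Euc n} {S T : Set (Euc n)} (hS : MeasurableSet S)
    (hT : MeasurableSet T) (hST : ∀ w ∈ S, ∀ s ∈ Icc (0 : ℝ) 1, w + s • v ∈ T) :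
    ∫⁻ w in S, ENNReal.ofReal (|f w| ^ q) ≤ ENNReal.ofReal (2 ^ (q - 1)) *
      ((∫⁻ w in S, ENNReal.ofReal (|f (w + v)| ^ q)) +
        ∫⁻ w in T, ENNReal.ofReal (‖v‖ ^ q * ‖fderiv ℝ f w‖ ^ q)) := by
  have hq0 : 0 < q := by linarith
  set G : Euc n → ℝ≥0∞ := fun w => ENNReal.ofReal (‖v‖ ^ q * ‖fderiv ℝ f w‖ ^ q) with hG
  have hGc : Continuous G := ENNReal.continuous_ofReal.comp (continuous_const.mul
    ((hf.continuous_fderiv one_ne_zero).norm.rpow_const fun _ => Or.inr hq0.le))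
  have hfub : ∫⁻ w in S, ∫⁻ s in Icc (0 : ℝ) 1, G (w + s • v) ≤ ∫⁻ w in T, G w := by
    rw [lintegral_lintegral_swap]
    · calc ∫⁻ s in Icc (0 : ℝ) 1, ∫⁻ w in S, G (w + s • v)
          ≤ ∫⁻ s in Icc (0 : ℝ) 1, ∫⁻ w in T, G w := by
            refine setLIntegral_mono' measurableSet_Icc fun s hs => ?_
            rw [← lintegral_indicator hS, ← lintegral_indicator hT,
              ← lintegral_add_right_eq_self (T.indicator G) (s • v)]
            refine lintegral_mono fun w => ?_
            by_cases hw : w ∈ S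
            · rw [indicator_of_mem hw, indicator_of_mem (hST w hw s hs)]
            · rw [indicator_of_notMem hw]; exact zero_le
        _ = ∫⁻ w in T, G w := by simp
    · exact (Continuous.measurable (by fun_prop)).aemeasurable
  calc ∫⁻ w in S, ENNReal.ofReal (|f w| ^ q)
      ≤ ∫⁻ w in S, ENNReal.ofReal (2 ^ (q - 1)) * (ENNReal.ofReal (|f (w + v)| ^ q) +
          ∫⁻ s in Icc (0 : ℝ) 1, G (w + s • v)) :=
        lintegral_mono fun w => abs_rpow_le_translate_add hq hf w v
    _ = ENNReal.ofReal (2 ^ (q - 1)) * ((∫⁻ w in S, ENNReal.ofReal (|f (w + v)| ^ q)) +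
          ∫⁻ w in S, ∫⁻ s in Icc (0 : ℝ) 1, G (w + s • v)) := by
        rw [lintegral_const_mul' _ _ ENNReal.ofReal_ne_top, lintegral_add_left]
        have : Continuous fun w => |f (w + v)| ^ q :=
          (hf.continuous.comp (continuous_add_const v)).abs.rpow_const fun _ => Or.inr hq0.le
        exact (ENNReal.continuous_ofReal.comp this).measurable
    _ ≤ _ := by gcongr

/-- Powers of the distance to the boundary are bounded above and below on compact subsets. -/
lemma exists_bdist_rpow_bounds {n : ℕ} {Ω : Set (Euc n)} (hΩ : IsOpen Ω)
    (hne : (frontier Ω).Nonempty) {K : Set (Euc n)} (hK : IsCompact K) (hKΩ : K ⊆ Ω) (c : ℝ) :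
    ∃ m M : ℝ, 0 < m ∧ 0 < M ∧ ∀ x ∈ K, m ≤ bdist Ω x ^ c ∧ bdist Ω x ^ c ≤ M := by
  rcases K.eq_empty_or_nonempty with rfl | hKne
  · exact ⟨1, 1, one_pos, one_pos, by simp⟩
  have hpos : ∀ x ∈ K, 0 < bdist Ω x := fun x hx => bdist_pos hΩ hne (hKΩ hx)
  have hc : ContinuousOn (fun x => bdist Ω x ^ c) K :=
    (continuous_bdist Ω).continuousOn.rpow_const fun x hx => Or.inl (hpos x hx).ne'
  obtain ⟨x, hx, hxm⟩ := hK.exists_isMinOn hKne hc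
  obtain ⟨y, hy, hyM⟩ := hK.exists_isMaxOn hKne hc
  exact ⟨_, _, Real.rpow_pos_of_pos (hpos x hx) c, Real.rpow_pos_of_pos (hpos y hy) c,
    fun z hz => ⟨hxm hz, hyM hz⟩⟩

/-- Within a ball, Hardy's inequality spreads from a neighbourhood of one point to a neighbourhood
of every other, because `f` changes under a translation by at most an integral of its gradient. -/
lemma HardyOn.exists_nhds_of_ball {n : ℕ} {Ω : Set (Euc n)} (hΩ : IsOpen Ω)
    (hne : (frontier Ω).Nonempty) {q a : ℝ} (hq : 1 < q) {x y z : Euc n} {R : ℝ}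
    (hR : Metric.closedBall x R ⊆ Ω) (hy : y ∈ Metric.ball x R) (hz : z ∈ Metric.ball x R)
    {U : Set (Euc n)} (hU : U ∈ 𝓝 y) (h : HardyOn Ω q a U) : ∃ V ∈ 𝓝 z, HardyOn Ω q a V := by
  have hq0 : 0 < q := by linarith
  obtain ⟨C, hC, hC'⟩ := h
  obtain ⟨m, M, hm, hM, hmM⟩ := exists_bdist_rpow_bounds hΩ hne (isCompact_closedBall x R) hR (a - q)
  obtain ⟨m', M', hm', -, hmM'⟩ := exists_bdist_rpow_bounds hΩ hne (isCompact_closedBall x R) hR a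
  obtain ⟨s₁, hs₁, hs₁'⟩ := Metric.mem_nhds_iff.1 (inter_mem hU (Metric.isOpen_ball.mem_nhds hy))
  obtain ⟨s₂, hs₂, hs₂'⟩ := Metric.mem_nhds_iff.1 (Metric.isOpen_ball.mem_nhds hz)
  set s := min s₁ s₂ with hs
  have hs0 : 0 < s := lt_min hs₁ hs₂
  have hsy : Metric.ball y s ⊆ U ∩ Metric.ball x R :=
    (Metric.ball_subset_ball (min_le_left _ _)).trans hs₁'
  have hsz : Metric.ball z s ⊆ Metric.ball x R :=
    (Metric.ball_subset_ball (min_le_right _ _)).trans hs₂'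
  set v := y - z with hv
  have hshift : ∀ w, w ∈ Metric.ball z s ↔ w + v ∈ Metric.ball y s := fun w => by
    rw [Metric.mem_ball, Metric.mem_ball, dist_eq_norm, dist_eq_norm, hv]
    congr! 2; abel
  have hbΩ : Metric.ball x R ⊆ Ω := Metric.ball_subset_closedBall.trans hR
  set B := 2 ^ (q - 1) * (m⁻¹ * C + ‖v‖ ^ q * m'⁻¹) with hB
  have hB0 : 0 < B := by positivity
  refine ⟨Metric.ball z s, Metric.ball_mem_nhds z hs0, M * B, by positivity, fun f hf => ?_⟩
  set D := ∫⁻ x in Ω, ENNReal.ofReal (‖fderiv ℝ f x‖ ^ q * bdist Ω x ^ a) with hD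
  have hf1 : ContDiff ℝ 1 f := hf.contDiff.of_le (by norm_cast)
  have hsub : ∀ w ∈ Metric.ball z s, ∀ τ ∈ Icc (0 : ℝ) 1, w + τ • v ∈ Metric.ball x R := by
    intro w hw τ hτ
    have h1 := (convex_ball x R).add_smul_sub_mem (hsz hw) (hsy ((hshift w).1 hw)).2 hτ
    simpa using h1
  have e1 : ∫⁻ w in Metric.ball z s, ENNReal.ofReal (|f (w + v)| ^ q) ≤
      ENNReal.ofReal (m⁻¹ * C) * D := by
    calc ∫⁻ w in Metric.ball z s, ENNReal.ofReal (|f (w + v)| ^ q)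
        ≤ ∫⁻ w in Metric.ball y s, ENNReal.ofReal (|f w| ^ q) := by
          rw [← lintegral_indicator Metric.isOpen_ball.measurableSet,
            ← lintegral_indicator Metric.isOpen_ball.measurableSet,
            ← lintegral_add_right_eq_self
              ((Metric.ball y s).indicator fun w => ENNReal.ofReal (|f w| ^ q)) v]
          refine lintegral_mono fun w => ?_
          by_cases hw : w ∈ Metric.ball z s
          · rw [indicator_of_mem hw, indicator_of_mem ((hshift w).1 hw)]
          · rw [indicator_of_notMem hw]; exact zero_le
      _ ≤ ∫⁻ w in Metric.ball y s, ENNReal.ofReal m⁻¹ *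
            ENNReal.ofReal (|f w| ^ q * bdist Ω w ^ (a - q)) := by
          refine setLIntegral_mono' Metric.isOpen_ball.measurableSet fun w hw => ?_
          rw [← ENNReal.ofReal_mul (by positivity)]
          apply ENNReal.ofReal_le_ofReal
          have h1 := (hmM w (Metric.ball_subset_closedBall (hsy hw).2)).1
          rw [inv_mul_eq_div, le_div_iff₀ hm]
          gcongr
      _ = ENNReal.ofReal m⁻¹ * ∫⁻ w in Metric.ball y s,
            ENNReal.ofReal (|f w| ^ q * bdist Ω w ^ (a - q)) :=
          lintegral_const_mul' _ _ ENNReal.ofReal_ne_top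
      _ ≤ ENNReal.ofReal m⁻¹ * (ENNReal.ofReal C * D) := by
          gcongr
          refine (lintegral_mono_set fun w hw => ?_).trans (hC' f hf)
          exact ⟨hbΩ (hsy hw).2, (hsy hw).1⟩
      _ = _ := by rw [ENNReal.ofReal_mul (by positivity), mul_assoc]
  have e2 : ∫⁻ w in Metric.ball x R, ENNReal.ofReal (‖v‖ ^ q * ‖fderiv ℝ f w‖ ^ q) ≤
      ENNReal.ofReal (‖v‖ ^ q * m'⁻¹) * D := by
    calc ∫⁻ w in Metric.ball x R, ENNReal.ofReal (‖v‖ ^ q * ‖fderiv ℝ f w‖ ^ q)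
        ≤ ∫⁻ w in Metric.ball x R, ENNReal.ofReal (‖v‖ ^ q * m'⁻¹) *
            ENNReal.ofReal (‖fderiv ℝ f w‖ ^ q * bdist Ω w ^ a) := by
          refine setLIntegral_mono' Metric.isOpen_ball.measurableSet fun w hw => ?_
          rw [← ENNReal.ofReal_mul (by positivity), mul_assoc]
          apply ENNReal.ofReal_le_ofReal
          gcongr
          have h1 := (hmM' w (Metric.ball_subset_closedBall hw)).1
          rw [inv_mul_eq_div, le_div_iff₀ hm']
          gcongr
      _ = ENNReal.ofReal (‖v‖ ^ q * m'⁻¹) * ∫⁻ w in Metric.ball x R,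
            ENNReal.ofReal (‖fderiv ℝ f w‖ ^ q * bdist Ω w ^ a) :=
          lintegral_const_mul' _ _ ENNReal.ofReal_ne_top
      _ ≤ _ := by gcongr; exact lintegral_mono_set hbΩ
  calc ∫⁻ w in Ω ∩ Metric.ball z s, ENNReal.ofReal (|f w| ^ q * bdist Ω w ^ (a - q))
      ≤ ∫⁻ w in Metric.ball z s, ENNReal.ofReal (|f w| ^ q * bdist Ω w ^ (a - q)) :=
        lintegral_mono_set inter_subset_right
    _ ≤ ∫⁻ w in Metric.ball z s, ENNReal.ofReal M * ENNReal.ofReal (|f w| ^ q) := by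
        refine setLIntegral_mono' Metric.isOpen_ball.measurableSet fun w hw => ?_
        rw [← ENNReal.ofReal_mul hM.le]
        apply ENNReal.ofReal_le_ofReal
        have h1 := (hmM w (Metric.ball_subset_closedBall (hsz hw))).2
        rw [mul_comm M]
        gcongr
    _ = ENNReal.ofReal M * ∫⁻ w in Metric.ball z s, ENNReal.ofReal (|f w| ^ q) :=
        lintegral_const_mul' _ _ ENNReal.ofReal_ne_top
    _ ≤ ENNReal.ofReal M * (ENNReal.ofReal (2 ^ (q - 1)) *
          (ENNReal.ofReal (m⁻¹ * C) * D + ENNReal.ofReal (‖v‖ ^ q * m'⁻¹) * D)) := by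
        gcongr
        refine (lintegral_abs_rpow_le_translate_add hq hf1 Metric.isOpen_ball.measurableSet
          Metric.isOpen_ball.measurableSet hsub).trans ?_
        gcongr
    _ = ENNReal.ofReal (M * B) * D := by
        rw [ENNReal.ofReal_mul hM.le, hB, ENNReal.ofReal_mul (p := 2 ^ (q - 1)) (by positivity),
          ENNReal.ofReal_add (by positivity) (by positivity)]
        ring

lemma HardyOn.mono {n : ℕ} {Ω : Set (Euc n)} {q a : ℝ} {U V : Set (Euc n)} (hUV : U ⊆ V)
    (h : HardyOn Ω q a V) : HardyOn Ω q a U := by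
  obtain ⟨C, hC, hC'⟩ := h
  exact ⟨C, hC, fun f hf =>
    (lintegral_mono_set (inter_subset_inter_right _ hUV)).trans (hC' f hf)⟩

lemma HardyOn.union {n : ℕ} {Ω : Set (Euc n)} {q a : ℝ} {U V : Set (Euc n)}
    (hU : HardyOn Ω q a U) (hV : HardyOn Ω q a V) : HardyOn Ω q a (U ∪ V) := by
  obtain ⟨C, hC, hC'⟩ := hU
  obtain ⟨C₁, hC₁, hC₁'⟩ := hV
  refine ⟨C + C₁, by positivity, fun f hf => ?_⟩
  rw [inter_union_distrib_left, ENNReal.ofReal_add hC.le hC₁.le, add_mul]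
  exact (lintegral_union_le _ _ _).trans (add_le_add (hC' f hf) (hC₁' f hf))

/-- **Hardy's inequality** on a bounded Lipschitz domain, with powers of the distance to the
boundary as weights. -/
theorem exists_hardy {n : ℕ} (hn : 1 ≤ n) {Ω : Set (Euc n)}
    (hΩ : IsBoundedLipschitzDomain Ω) {q a : ℝ} (hq : 1 < q) (ha : a < q - 1) :
    ∃ C : ℝ, 0 < C ∧ ∀ f : Euc n → ℝ, IsTestFunction Ω f →
      ∫⁻ x in Ω, ENNReal.ofReal (|f x| ^ q * bdist Ω x ^ (a - q)) ≤
        ENNReal.ofReal C * ∫⁻ x in Ω, ENNReal.ofReal (‖fderiv ℝ f x‖ ^ q * bdist Ω x ^ a) := by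
  have hne := hΩ.frontier_nonempty hn
  set S : Set (Euc n) := {x | ∃ U ∈ 𝓝 x, HardyOn Ω q a U} with hS
  have hSo : IsOpen S := by
    refine isOpen_iff_mem_nhds.2 fun x ⟨U, hU, h⟩ => ?_
    filter_upwards [eventually_mem_nhds_iff.2 hU] with y hy using ⟨U, hy, h⟩
  have hball : ∀ x ∈ Ω, ∃ R > 0, Metric.closedBall x R ⊆ Ω := fun x hx =>
    Metric.nhds_basis_closedBall.mem_iff.1 (hΩ.isOpen.mem_nhds hx)
  have hSco : IsOpen (Ω \ S) := by
    refine isOpen_iff_mem_nhds.2 fun x ⟨hxΩ, hxS⟩ => ?_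
    obtain ⟨R, hR, hRΩ⟩ := hball x hxΩ
    filter_upwards [Metric.ball_mem_nhds x hR] with y hy
    refine ⟨hRΩ (Metric.ball_subset_closedBall hy), fun ⟨U, hU, h⟩ => hxS ?_⟩
    exact h.exists_nhds_of_ball hΩ.isOpen hne hq hRΩ hy (Metric.mem_ball_self hR) hU
  have hfS : frontier Ω ⊆ S := fun x hx => hardyOn_nhds_frontier hΩ hq ha hx
  have hΩS : Ω ⊆ S := by
    rcases hΩ.isConnected.isPreconnected.subset_or_subset hSo hSco disjoint_sdiff_right
      (fun x hx => (em (x ∈ S)).imp id fun h => ⟨hx, h⟩) with h | h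
    · exact h
    · obtain ⟨x₀, hx₀⟩ := hne
      obtain ⟨y, hyS, hyΩ⟩ := mem_closure_iff.1 (frontier_subset_closure hx₀) S hSo (hfS hx₀)
      exact absurd hyS (h hyΩ).2
  have hcl : closure Ω ⊆ S := by
    intro x hx
    by_cases hxΩ : x ∈ Ω
    · exact hΩS hxΩ
    · exact hfS (by rw [hΩ.isOpen.frontier_eq]; exact ⟨hx, hxΩ⟩)
  have hcpt : IsCompact (closure Ω) := hΩ.isBounded.isCompact_closure
  have hall : HardyOn Ω q a (closure Ω) := by
    refine hcpt.induction_on ⟨1, one_pos, by simp⟩ (fun U V h hV => hV.mono h)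
      (fun U V hU hV => hU.union hV) fun x hx => ?_
    obtain ⟨U, hU, h⟩ := hcl hx
    exact ⟨U, mem_nhdsWithin_of_mem_nhds hU, h⟩
  obtain ⟨C, hC, hC'⟩ := hall
  refine ⟨C, hC, fun f hf => ?_⟩
  have := hC' f hf
  rwa [inter_eq_left.2 subset_closure] at this

/-! ### First and second derivatives of test functions -/

lemma fderiv_single_eq_gradient {n : ℕ} (u : Euc n → ℝ) (x : Euc n) (i : Fin n) :
    fderiv ℝ u x (EuclideanSpace.single i 1) = gradient u x i := by
  have h : inner ℝ (gradient u x) (EuclideanSpace.single i (1 : ℝ)) =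
      fderiv ℝ u x (EuclideanSpace.single i 1) := by
    rw [gradient, InnerProductSpace.toDual_symm_apply]
  rw [← h, EuclideanSpace.inner_single_right]
  simp

lemma norm_gradient {n : ℕ} (u : Euc n → ℝ) (x : Euc n) : ‖gradient u x‖ = ‖fderiv ℝ u x‖ := by
  rw [gradient, LinearIsometryEquiv.norm_map]

lemma norm_gradient_sq {n : ℕ} (u : Euc n → ℝ) (x : Euc n) :
    ‖gradient u x‖ ^ 2 = ∑ i, fderiv ℝ u x (EuclideanSpace.single i 1) ^ 2 := by
  rw [EuclideanSpace.real_norm_sq_eq]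
  simp only [fderiv_single_eq_gradient]

lemma abs_fderiv_single_le {n : ℕ} (u : Euc n → ℝ) (x : Euc n) (i : Fin n) :
    |fderiv ℝ u x (EuclideanSpace.single i 1)| ≤ ‖gradient u x‖ := by
  rw [norm_gradient]
  simpa using (fderiv ℝ u x).le_opNorm (EuclideanSpace.single i 1)

lemma hessNorm_nonneg {n : ℕ} (u : Euc n → ℝ) (x : Euc n) : 0 ≤ hessNorm u x := Real.sqrt_nonneg _

lemma hessNorm_sq {n : ℕ} (u : Euc n → ℝ) (x : Euc n) :
    hessNorm u x ^ 2 = ∑ i, ∑ j, secondPartial u i j x ^ 2 :=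
  Real.sq_sqrt (Finset.sum_nonneg fun _ _ => Finset.sum_nonneg fun _ _ => sq_nonneg _)

lemma sum_secondPartial_sq_le {n : ℕ} (u : Euc n → ℝ) (x : Euc n) (i : Fin n) :
    ∑ j, secondPartial u i j x ^ 2 ≤ hessNorm u x ^ 2 := by
  rw [hessNorm_sq]
  exact Finset.single_le_sum (f := fun i => ∑ j, secondPartial u i j x ^ 2)
    (fun _ _ => Finset.sum_nonneg fun _ _ => sq_nonneg _) (Finset.mem_univ i)

lemma sum_secondPartial_sq_le' {n : ℕ} (u : Euc n → ℝ) (x : Euc n) (j : Fin n) :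
    ∑ i, secondPartial u i j x ^ 2 ≤ hessNorm u x ^ 2 := by
  rw [hessNorm_sq]
  exact Finset.sum_le_sum fun i _ => Finset.single_le_sum (f := fun j => secondPartial u i j x ^ 2)
    (fun _ _ => sq_nonneg _) (Finset.mem_univ j)

lemma abs_secondPartial_le {n : ℕ} (u : Euc n → ℝ) (x : Euc n) (i j : Fin n) :
    |secondPartial u i j x| ≤ hessNorm u x := by
  refine abs_le_of_sq_le_sq ?_ (hessNorm_nonneg u x)
  refine le_trans ?_ (sum_secondPartial_sq_le u x i)
  exact Finset.single_le_sum (f := fun j => secondPartial u i j x ^ 2)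
    (fun _ _ => sq_nonneg _) (Finset.mem_univ j)

lemma norm_fderiv_partial_le_hessNorm {n : ℕ} (u : Euc n → ℝ) (x : Euc n) (i : Fin n) :
    ‖fderiv ℝ (fun y => fderiv ℝ u y (EuclideanSpace.single i 1)) x‖ ≤ hessNorm u x := by
  rw [← norm_gradient]
  refine abs_le_of_sq_le_sq' ?_ (hessNorm_nonneg u x) |>.2
  rw [norm_gradient_sq]
  exact sum_secondPartial_sq_le u x i

namespace IsTestFunction

variable {n : ℕ} {Ω : Set (Euc n)} {u : Euc n → ℝ}

lemma partialDeriv (hu : IsTestFunction Ω u) (i : Fin n) :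
    IsTestFunction Ω (fun y => fderiv ℝ u y (EuclideanSpace.single i 1)) where
  contDiff := (hu.contDiff.fderiv_right (m := ∞) (by norm_cast)).clm_apply contDiff_const
  hasCompactSupport := hu.hasCompactSupport.fderiv_apply (𝕜 := ℝ) _
  tsupport_subset := (tsupport_fderiv_apply_subset ℝ _).trans hu.tsupport_subset

lemma const_mul (hu : IsTestFunction Ω u) (c : ℝ) : IsTestFunction Ω (fun x => c * u x) where
  contDiff := contDiff_const.mul hu.contDiff
  hasCompactSupport := hu.hasCompactSupport.mul_left
  tsupport_subset := (tsupport_mul_subset_right (f := fun _ => c)).trans hu.tsupport_subset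

lemma contDiff_one (hu : IsTestFunction Ω u) : ContDiff ℝ 1 u := hu.contDiff.of_le (by norm_cast)

lemma continuous_gradient (hu : IsTestFunction Ω u) : Continuous (gradient u) :=
  (InnerProductSpace.toDual ℝ (Euc n)).symm.continuous.comp
    (hu.contDiff_one.continuous_fderiv one_ne_zero)

lemma continuous_secondPartial (hu : IsTestFunction Ω u) (i j : Fin n) :
    Continuous (secondPartial u i j) :=
  ((hu.partialDeriv i).contDiff_one.continuous_fderiv one_ne_zero).clm_apply continuous_const

lemma continuous_hessNorm (hu : IsTestFunction Ω u) : Continuous (hessNorm u) := by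
  have := hu.continuous_secondPartial
  unfold hessNorm
  fun_prop

lemma gradient_eq_zero {x : Euc n} (hx : x ∉ tsupport u) : gradient u x = 0 := by
  have : fderiv ℝ u x = 0 := image_eq_zero_of_notMem_tsupport fun h =>
    hx (tsupport_fderiv_subset ℝ h)
  rw [gradient, this, map_zero]

end IsTestFunction

/-! ### Integration by parts against the weight -/

/-- Near a compact subset of `Ω`, the weight `δ ^ a` agrees with a globally Lipschitz function. -/
lemma exists_lipschitz_weight {n : ℕ} {Ω : Set (Euc n)} (hΩ : IsOpen Ω)
    (hne : (frontier Ω).Nonempty) {K : Set (Euc n)} (hK : IsCompact K) (hKΩ : K ⊆ Ω) (a : ℝ) :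
    ∃ (w : Euc n → ℝ) (L : NNReal), LipschitzWith L w ∧ (∀ x ∈ K, w x = bdist Ω x ^ a) ∧
      ∀ᵐ x : Euc n, x ∈ K → ∀ v, |lineDeriv ℝ w x v| ≤ |a| * bdist Ω x ^ (a - 1) * ‖v‖ := by
  obtain ⟨m, M, hm, hM, hmM⟩ := exists_bdist_rpow_bounds hΩ hne hK hKΩ 1
  simp only [Real.rpow_one] at hmM
  have hle : m / 2 ≤ M + m := by linarith
  have hcd : ContDiffOn ℝ 1 (fun s : ℝ => s ^ a) (Icc (m / 2) (M + m)) := fun s hs =>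
    (Real.contDiffAt_rpow_const_of_ne (by linarith [hs.1] : (0 : ℝ) < s).ne').contDiffWithinAt
  obtain ⟨L, hL⟩ := hcd.exists_lipschitzOnWith one_ne_zero (convex_Icc _ _) isCompact_Icc
  set w : Euc n → ℝ := fun x => (projIcc (m / 2) (M + m) hle (bdist Ω x) : ℝ) ^ a with hw
  have hδ : LipschitzWith 1 (bdist Ω) := Metric.lipschitz_infDist_pt _
  have hwL : LipschitzWith (L * (1 * 1)) w := by
    have h1 : LipschitzWith L (fun s : Icc (m / 2) (M + m) => (s : ℝ) ^ a) :=
      (lipschitzOnWith_iff_restrict.1 hL)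
    exact h1.comp ((LipschitzWith.projIcc hle).comp hδ)
  have hweq : ∀ x, m / 2 < bdist Ω x → bdist Ω x < M + m → w x = bdist Ω x ^ a := fun x h1 h2 => by
    simp only [hw]
    rw [projIcc_of_mem hle ⟨h1.le, h2.le⟩]
  refine ⟨w, _, hwL, fun x hx => hweq x ?_ ?_, ?_⟩
  · linarith [(hmM x hx).1]
  · linarith [(hmM x hx).2]
  · filter_upwards [hδ.ae_differentiableAt] with x hx hxK v
    have h1 : m / 2 < bdist Ω x := by linarith [(hmM x hxK).1]
    have h2 : bdist Ω x < M + m := by linarith [(hmM x hxK).2]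
    have hpos : 0 < bdist Ω x := by linarith
    have hl := hx.hasFDerivAt.hasLineDerivAt v
    have hle : ‖fderiv ℝ (bdist Ω) x v‖ ≤ (1 : NNReal) * ‖v‖ := hl.le_of_lipschitz hδ
    have hp : HasLineDerivAt ℝ (fun y => bdist Ω y ^ a)
        (fderiv ℝ (bdist Ω) x v * a * bdist Ω x ^ (a - 1)) x v := by
      have := HasDerivAt.rpow_const (p := a) hl (Or.inl (by simpa using hpos.ne'))
      simpa [HasLineDerivAt] using this
    have hev : w =ᶠ[𝓝 x] fun y => bdist Ω y ^ a := by
      filter_upwards [(isOpen_lt continuous_const (continuous_bdist Ω)).mem_nhds h1,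
        (isOpen_lt (continuous_bdist Ω) continuous_const).mem_nhds h2] with y hy1 hy2
      exact hweq y hy1 hy2
    rw [(hp.congr_of_eventuallyEq hev).lineDeriv, abs_mul, abs_mul,
      abs_of_nonneg (Real.rpow_nonneg hpos.le _)]
    rw [Real.norm_eq_abs, NNReal.coe_one, one_mul] at hle
    have : 0 ≤ bdist Ω x ^ (a - 1) := by positivity
    calc |fderiv ℝ (bdist Ω) x v| * |a| * bdist Ω x ^ (a - 1)
        ≤ ‖v‖ * |a| * bdist Ω x ^ (a - 1) := by gcongr
      _ = _ := by ring

/-- The length of the gradient, regularized so as to be smooth and positive. -/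
noncomputable def gradReg {n : ℕ} (ε : ℝ) (u : Euc n → ℝ) (x : Euc n) : ℝ := Real.sqrt (ε ^ 2 + ‖gradient u x‖ ^ 2)

lemma gradReg_pos {n : ℕ} {ε : ℝ} (hε : 0 < ε) (u : Euc n → ℝ) (x : Euc n) : 0 < gradReg ε u x :=
  Real.sqrt_pos.2 (by positivity)

lemma norm_gradient_le_gradReg {n : ℕ} (ε : ℝ) (u : Euc n → ℝ) (x : Euc n) :
    ‖gradient u x‖ ≤ gradReg ε u x :=
  Real.le_sqrt_of_sq_le (by nlinarith [sq_nonneg ε])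

lemma IsTestFunction.contDiff_gradReg {n : ℕ} {Ω : Set (Euc n)} {u : Euc n → ℝ}
    (hu : IsTestFunction Ω u) {ε : ℝ} (hε : 0 < ε) : ContDiff ℝ 1 (gradReg ε u) := by
  unfold gradReg
  simp only [norm_gradient_sq]
  refine ContDiff.sqrt (contDiff_const.add
    (ContDiff.sum fun i _ => ((hu.partialDeriv i).contDiff_one.pow 2))) fun x => ?_
  have : 0 ≤ ∑ i, fderiv ℝ u x (EuclideanSpace.single i 1) ^ 2 :=
    Finset.sum_nonneg fun _ _ => sq_nonneg _
  positivity

lemma IsTestFunction.abs_fderiv_gradReg_le {n : ℕ} {Ω : Set (Euc n)} {u : Euc n → ℝ}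
    (hu : IsTestFunction Ω u) {ε : ℝ} (hε : 0 < ε) (x : Euc n) (j : Fin n) :
    |fderiv ℝ (gradReg ε u) x (EuclideanSpace.single j 1)| ≤ hessNorm u x := by
  set d : Fin n → ℝ := fun i => fderiv ℝ u x (EuclideanSpace.single i 1) with hd
  set D := fderiv ℝ (gradReg ε u) x (EuclideanSpace.single j 1) with hD
  have hs := gradReg_pos hε u x
  -- differentiate the square of `gradReg ε u`
  have h1 : gradReg ε u x * D = ∑ i, d i * secondPartial u i j x := by
    have hsq : (fun y => gradReg ε u y ^ 2) =
        fun y => ε ^ 2 + ∑ i, fderiv ℝ u y (EuclideanSpace.single i 1) ^ 2 := by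
      ext y; rw [gradReg, Real.sq_sqrt (by positivity), norm_gradient_sq]
    have e1 : HasFDerivAt (fun y => gradReg ε u y ^ 2) _ x :=
      (((hu.contDiff_gradReg hε).differentiable one_ne_zero) x).hasFDerivAt.pow 2
    have e2 : HasFDerivAt
        (fun y => ε ^ 2 + ∑ i, fderiv ℝ u y (EuclideanSpace.single i 1) ^ 2) _ x :=
      (HasFDerivAt.fun_sum fun i _ =>
        ((((hu.partialDeriv i).contDiff_one.differentiable one_ne_zero) x).hasFDerivAt.pow 2)).const_add _
    rw [hsq] at e1
    have e3 := DFunLike.congr_fun (e1.unique e2) (EuclideanSpace.single j (1 : ℝ))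
    simp at e3
    have e4 : 2 * (gradReg ε u x * D) = 2 * ∑ i, d i * secondPartial u i j x := by
      rw [Finset.mul_sum]
      simp only [← mul_assoc]
      exact e3
    linarith
  have h2 : (∑ i, d i * secondPartial u i j x) ^ 2 ≤ (gradReg ε u x * hessNorm u x) ^ 2 := by
    refine (Finset.sum_mul_sq_le_sq_mul_sq _ _ _).trans ?_
    rw [mul_pow]
    refine mul_le_mul ?_ (sum_secondPartial_sq_le' u x j)
      (Finset.sum_nonneg fun _ _ => sq_nonneg _) (sq_nonneg _)
    rw [gradReg, Real.sq_sqrt (by positivity), norm_gradient_sq]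
    nlinarith [sq_nonneg ε]
  rw [← h1] at h2
  have h3 := abs_le_of_sq_le_sq h2 (mul_nonneg hs.le (hessNorm_nonneg u x))
  rw [abs_mul, abs_of_pos hs] at h3
  exact le_of_mul_le_mul_left h3 hs

/-- Integration by parts of one summand of `∫ ‖∇u‖² m(s) δ ^ a`, where `s` is the regularized length
of the gradient: one derivative is moved from `u` to `∂ᵢu · m(s)` and to the weight. -/
lemma IsTestFunction.integral_partial_sq_mul_le {n : ℕ} {Ω : Set (Euc n)} (hΩ : IsOpen Ω)
    (hne : (frontier Ω).Nonempty) {u : Euc n → ℝ} (hu : IsTestFunction Ω u) {ε : ℝ} (hε : 0 < ε)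
    (a : ℝ) {m : ℝ → ℝ} {C : ℝ} (hC : 0 ≤ C) (hm : ContDiffOn ℝ 1 m (Ioi 0))
    (hm0 : ∀ s, 0 < s → 0 ≤ m s) (hm' : ∀ s, 0 < s → |deriv m s| * s ≤ C * m s) (i : Fin n) :
    ∫ x in tsupport u, fderiv ℝ u x (EuclideanSpace.single i 1) ^ 2 * m (gradReg ε u x) *
        bdist Ω x ^ a ≤
      ∫ x in tsupport u, (1 + C + |a|) * (|u x| * m (gradReg ε u x) *
        (hessNorm u x + ‖gradient u x‖ / bdist Ω x)) * bdist Ω x ^ a := by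
  set K := tsupport u with hKdef
  have hK : IsCompact K := hu.hasCompactSupport
  have hKm : MeasurableSet K := hK.isClosed.measurableSet
  have hKΩ : K ⊆ Ω := hu.tsupport_subset
  obtain ⟨w, L, hwL, hwK, hwd⟩ := exists_lipschitz_weight hΩ hne hK hKΩ a
  have hδ : ∀ x ∈ K, 0 < bdist Ω x := fun x hx => bdist_pos hΩ hne (hKΩ hx)
  have hδc : ∀ c : ℝ, ContinuousOn (fun x => bdist Ω x ^ c) K := fun c =>
    (continuous_bdist Ω).continuousOn.rpow_const fun x hx => Or.inl (hδ x hx).ne'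
  set e : Euc n := EuclideanSpace.single i 1 with he
  set d : Euc n → ℝ := fun x => fderiv ℝ u x e with hd
  set s : Euc n → ℝ := gradReg ε u with hs
  have hs0 : ∀ x, 0 < s x := gradReg_pos hε u
  have hs1 : ContDiff ℝ 1 s := hu.contDiff_gradReg hε
  have hd1 : ContDiff ℝ 1 d := (hu.partialDeriv i).contDiff_one
  have hms : ContDiff ℝ 1 (fun x => m (s x)) := contDiff_iff_contDiffAt.2 fun x =>
    (hm.contDiffAt (Ioi_mem_nhds (hs0 x))).comp x hs1.contDiffAt
  set g : Euc n → ℝ := fun x => u x * (d x * m (s x)) with hg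
  have hg1 : ContDiff ℝ 1 g := hu.contDiff_one.mul (hd1.mul hms)
  have hgc : HasCompactSupport g := hu.hasCompactSupport.mul_right
  have hgK : tsupport g ⊆ K := tsupport_mul_subset_left
  obtain ⟨D, hgL⟩ := hg1.lipschitzWith_of_hasCompactSupport hgc one_ne_zero
  set R : Euc n → ℝ := fun x => fderiv ℝ g x e - d x ^ 2 * m (s x) with hR
  have hRb : ∀ x, |R x| ≤ (1 + C) * (|u x| * m (s x) * hessNorm u x) := by
    intro x
    have e1 : HasFDerivAt g _ x := (hu.contDiff_one.differentiable one_ne_zero x).hasFDerivAt.mul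
      ((hd1.differentiable one_ne_zero x).hasFDerivAt.mul
        (hms.differentiable one_ne_zero x).hasFDerivAt)
    have e2 : fderiv ℝ (fun x => m (s x)) x e = deriv m (s x) * fderiv ℝ s x e := by
      have hmd : DifferentiableAt ℝ m (s x) :=
        (hm.contDiffAt (Ioi_mem_nhds (hs0 x))).differentiableAt one_ne_zero
      have := hmd.hasDerivAt.comp_hasFDerivAt x (hs1.differentiable one_ne_zero x).hasFDerivAt
      rw [show (fun x => m (s x)) = m ∘ s from rfl, this.fderiv]
      simp
    have e3 : R x = u x * (secondPartial u i i x * m (s x)) +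
        u x * (d x * (deriv m (s x) * fderiv ℝ s x e)) := by
      simp only [hR]
      rw [e1.fderiv]
      simp only [add_apply, smul_apply, smul_eq_mul, e2]
      simp only [secondPartial, hd]
      ring
    have f1 : |secondPartial u i i x| ≤ hessNorm u x := abs_secondPartial_le u x i i
    have f2 : |fderiv ℝ s x e| ≤ hessNorm u x := hu.abs_fderiv_gradReg_le hε x i
    have f3 : |d x| ≤ s x := (abs_fderiv_single_le u x i).trans (norm_gradient_le_gradReg ε u x)
    have f4 := hm' _ (hs0 x)
    have f5 := hm0 _ (hs0 x)
    have f6 := hessNorm_nonneg u x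
    have f7 := (hs0 x).le
    rw [e3]
    refine (abs_add_le _ _).trans ?_
    simp only [abs_mul, abs_of_nonneg f5]
    calc |u x| * (|secondPartial u i i x| * m (s x)) +
          |u x| * (|d x| * (|deriv m (s x)| * |fderiv ℝ s x e|))
        ≤ |u x| * (hessNorm u x * m (s x)) +
          |u x| * (s x * (|deriv m (s x)| * hessNorm u x)) := by gcongr
      _ = |u x| * (hessNorm u x * m (s x)) +
          |u x| * ((|deriv m (s x)| * s x) * hessNorm u x) := by ring
      _ ≤ |u x| * (hessNorm u x * m (s x)) +
          |u x| * ((C * m (s x)) * hessNorm u x) := by gcongr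
      _ = _ := by ring
  have hRc : Continuous R :=
    ((hg1.continuous_fderiv one_ne_zero).clm_apply continuous_const).sub
      ((hd1.continuous.pow 2).mul hms.continuous)
  have hgK0 : ∀ x, x ∉ K → g x = 0 := fun x hx =>
    image_eq_zero_of_notMem_tsupport fun h => hx (hgK h)
  have hg'K0 : ∀ x, x ∉ K → fderiv ℝ g x = 0 := fun x hx =>
    image_eq_zero_of_notMem_tsupport fun h => hx (hgK (tsupport_fderiv_subset ℝ h))
  have hibp : ∫ x in K, fderiv ℝ g x e * bdist Ω x ^ a = - ∫ x in K, lineDeriv ℝ w x e * g x := by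
    have h := hwL.integral_lineDeriv_mul_eq (μ := volume) hgL hgc e
    have h1 := setIntegral_eq_integral_of_forall_compl_eq_zero (μ := volume) (s := K)
      (f := fun x => lineDeriv ℝ w x e * g x) (fun x hx => by rw [hgK0 x hx, mul_zero])
    have h2 := setIntegral_eq_integral_of_forall_compl_eq_zero (μ := volume) (s := K)
      (f := fun x => lineDeriv ℝ g x (-e) * w x) (fun x hx => by
        rw [(hg1.differentiable one_ne_zero x).lineDeriv_eq_fderiv, hg'K0 x hx]
        simp)
    rw [h1, h, ← h2, ← integral_neg]
    refine setIntegral_congr_fun hKm fun x hx => ?_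
    rw [(hg1.differentiable one_ne_zero x).lineDeriv_eq_fderiv, map_neg, hwK x hx]
    ring
  have hic : ∀ F : Euc n → ℝ, ContinuousOn F K → IntegrableOn F K := fun F hF =>
    hF.integrableOn_compact hK
  have hP : ∫ x in K, d x ^ 2 * m (s x) * bdist Ω x ^ a =
      (∫ x in K, fderiv ℝ g x e * bdist Ω x ^ a) - ∫ x in K, R x * bdist Ω x ^ a := by
    rw [← integral_sub]
    · refine setIntegral_congr_fun hKm fun x _ => ?_
      simp only [hR]; ring
    · exact hic _ ((((hg1.continuous_fderiv one_ne_zero).clm_apply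
        continuous_const).continuousOn).mul (hδc a))
    · exact hic _ (hRc.continuousOn.mul (hδc a))
  have hhc := hu.continuous_hessNorm
  have hgrc := hu.continuous_gradient
  have huc := hu.contDiff_one.continuous
  have hmc := hms.continuous
  have hb1 : |∫ x in K, lineDeriv ℝ w x e * g x| ≤
      ∫ x in K, |a| * (|u x| * m (s x) * (‖gradient u x‖ / bdist Ω x)) * bdist Ω x ^ a := by
    rw [← Real.norm_eq_abs]
    refine norm_integral_le_of_norm_le (hic _ ?_) ?_
    · refine ContinuousOn.mul (continuousOn_const.mul ((huc.abs.mul hmc).continuousOn.mul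
        (hgrc.norm.continuousOn.div (continuous_bdist Ω).continuousOn
          fun x hx => (hδ x hx).ne'))) (hδc a)
    · rw [ae_restrict_iff' hKm]
      filter_upwards [hwd] with x hx hxK
      have h1 := hx hxK e
      have hδx := hδ x hxK
      have f3 : |d x| ≤ ‖gradient u x‖ := abs_fderiv_single_le u x i
      have f5 := hm0 _ (hs0 x)
      rw [show ‖e‖ = 1 by simp [he], mul_one, Real.rpow_sub_one hδx.ne'] at h1
      simp only [hg, norm_mul, Real.norm_eq_abs, abs_of_nonneg f5]
      calc |lineDeriv ℝ w x e| * (|u x| * (|d x| * m (s x)))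
          ≤ (|a| * (bdist Ω x ^ a / bdist Ω x)) * (|u x| * (‖gradient u x‖ * m (s x))) := by gcongr
        _ = _ := by ring
  have hb2 : |∫ x in K, R x * bdist Ω x ^ a| ≤
      ∫ x in K, (1 + C) * (|u x| * m (s x) * hessNorm u x) * bdist Ω x ^ a := by
    rw [← Real.norm_eq_abs]
    refine norm_integral_le_of_norm_le (hic _ (ContinuousOn.mul
      (continuous_const.mul ((huc.abs.mul hmc).mul hhc)).continuousOn (hδc a))) ?_
    rw [ae_restrict_iff' hKm]
    refine .of_forall fun x hxK => ?_
    have hδx := Real.rpow_nonneg (hδ x hxK).le a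
    rw [norm_mul, Real.norm_eq_abs, Real.norm_eq_abs, abs_of_nonneg hδx]
    exact mul_le_mul_of_nonneg_right (hRb x) hδx
  have hb : ∫ x in K, d x ^ 2 * m (s x) * bdist Ω x ^ a ≤
      (∫ x in K, |a| * (|u x| * m (s x) * (‖gradient u x‖ / bdist Ω x)) * bdist Ω x ^ a) +
      ∫ x in K, (1 + C) * (|u x| * m (s x) * hessNorm u x) * bdist Ω x ^ a := by
    rw [hP, hibp]
    linarith [neg_abs_le (∫ x in K, lineDeriv ℝ w x e * g x),
      neg_abs_le (∫ x in K, R x * bdist Ω x ^ a)]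
  have hc1 : ContinuousOn
      (fun x => |a| * (|u x| * m (s x) * (‖gradient u x‖ / bdist Ω x)) * bdist Ω x ^ a) K :=
    ContinuousOn.mul (continuousOn_const.mul ((huc.abs.mul hmc).continuousOn.mul
        (hgrc.norm.continuousOn.div (continuous_bdist Ω).continuousOn
          fun x hx => (hδ x hx).ne'))) (hδc a)
  have hc2 : ContinuousOn
      (fun x => (1 + C) * (|u x| * m (s x) * hessNorm u x) * bdist Ω x ^ a) K :=
    ContinuousOn.mul
      (continuous_const.mul ((huc.abs.mul hmc).mul hhc)).continuousOn (hδc a)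
  have hc3 : ContinuousOn (fun x => (1 + C + |a|) * (|u x| * m (s x) *
      (hessNorm u x + ‖gradient u x‖ / bdist Ω x)) * bdist Ω x ^ a) K :=
    ContinuousOn.mul (continuousOn_const.mul ((huc.abs.mul hmc).continuousOn.mul
      (hhc.continuousOn.add (hgrc.norm.continuousOn.div (continuous_bdist Ω).continuousOn
          fun x hx => (hδ x hx).ne')))) (hδc a)
  refine hb.trans ?_
  rw [← integral_add (hic _ hc1) (hic _ hc2)]
  refine setIntegral_mono_on ((hic _ hc1).add (hic _ hc2)) (hic _ hc3) hKm fun x hxK => ?_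
  have hδx := hδ x hxK
  have hδa := Real.rpow_nonneg hδx.le a
  have f5 := hm0 _ (hs0 x)
  have f6 := hessNorm_nonneg u x
  have g1 : 0 ≤ |u x| * m (s x) * hessNorm u x * bdist Ω x ^ a := by positivity
  have g2 : 0 ≤ |u x| * m (s x) * (‖gradient u x‖ / bdist Ω x) * bdist Ω x ^ a := by positivity
  nlinarith [mul_nonneg (abs_nonneg a) g1, mul_nonneg (add_nonneg zero_le_one hC) g2]

/-! ### The modular inequality for the gradient -/

lemma norm_gradient_le_sum {n : ℕ} (u : Euc n → ℝ) (x : Euc n) :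
    ‖gradient u x‖ ≤ ∑ i, |fderiv ℝ u x (EuclideanSpace.single i 1)| := by
  have h0 : 0 ≤ ∑ i, |fderiv ℝ u x (EuclideanSpace.single i 1)| :=
    Finset.sum_nonneg fun _ _ => abs_nonneg _
  refine abs_le_of_sq_le_sq' ?_ h0 |>.2
  rw [norm_gradient_sq]
  simpa using Finset.sum_sq_le_sq_sum_of_nonneg
    (s := Finset.univ) (f := fun i => |fderiv ℝ u x (EuclideanSpace.single i 1)|)
    (fun _ _ => abs_nonneg _)

/-- Hardy's inequality for the gradient: in `L^q` with weight, `‖∇u‖ / δ` is controlled by the second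
derivatives. -/
lemma exists_hardy_gradient {n : ℕ} (hn : 1 ≤ n) {Ω : Set (Euc n)}
    (hΩ : IsBoundedLipschitzDomain Ω) {q a : ℝ} (hq : 1 < q) (ha : a < q - 1) :
    ∃ C : ℝ, 0 < C ∧ ∀ u : Euc n → ℝ, IsTestFunction Ω u →
      ∫⁻ x in Ω, ENNReal.ofReal
          ((hessNorm u x + ‖gradient u x‖ / bdist Ω x) ^ q * bdist Ω x ^ a) ≤
        ENNReal.ofReal C * ∫⁻ x in Ω, ENNReal.ofReal (hessNorm u x ^ q * bdist Ω x ^ a) := by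
  obtain ⟨C, hC, hC'⟩ := exists_hardy hn hΩ hq ha
  have hq0 : 0 < q := by linarith
  have hne := hΩ.frontier_nonempty hn
  set A : ℝ := 2 ^ (q - 1) with hA
  have hA0 : 0 < A := by positivity
  set N : ℝ := (n : ℝ) ^ (q - 1) with hN
  have hN0 : 0 ≤ N := by positivity
  refine ⟨A + A * N * (n * C), by positivity, fun u hu => ?_⟩
  set H := ∫⁻ x in Ω, ENNReal.ofReal (hessNorm u x ^ q * bdist Ω x ^ a) with hH
  set d : Fin n → Euc n → ℝ := fun i x => fderiv ℝ u x (EuclideanSpace.single i 1) with hd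
  have hdc : ∀ i, Continuous (d i) := fun i => (hu.partialDeriv i).contDiff_one.continuous
  have hmeas : ∀ i, Measurable fun x => ENNReal.ofReal (|d i x| ^ q * bdist Ω x ^ (a - q)) := by
    intro i
    have h1 := (hdc i).measurable
    have h2 := (continuous_bdist Ω).measurable
    fun_prop
  have hmeasH : Measurable fun x => ENNReal.ofReal (hessNorm u x ^ q * bdist Ω x ^ a) := by
    have h1 := hu.continuous_hessNorm.measurable
    have h2 := (continuous_bdist Ω).measurable
    fun_prop
  have hpt : ∀ x ∈ Ω, ENNReal.ofReal
      ((hessNorm u x + ‖gradient u x‖ / bdist Ω x) ^ q * bdist Ω x ^ a) ≤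
      ENNReal.ofReal A * ENNReal.ofReal (hessNorm u x ^ q * bdist Ω x ^ a) +
        ENNReal.ofReal (A * N) *
          ∑ i, ENNReal.ofReal (|d i x| ^ q * bdist Ω x ^ (a - q)) := by
    intro x hx
    have hδ := bdist_pos hΩ.isOpen hne hx
    have hh := hessNorm_nonneg u x
    have h1 : (hessNorm u x + ‖gradient u x‖ / bdist Ω x) ^ q ≤
        A * (hessNorm u x ^ q + (‖gradient u x‖ / bdist Ω x) ^ q) := by
      exact_mod_cast NNReal.rpow_add_le_mul_rpow_add_rpow ⟨_, hh⟩
        ⟨‖gradient u x‖ / bdist Ω x, by positivity⟩ hq.le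
    have h2 : ‖gradient u x‖ ^ q ≤ N * ∑ i, |d i x| ^ q := by
      refine (Real.rpow_le_rpow (norm_nonneg _) (norm_gradient_le_sum u x) hq0.le).trans ?_
      simpa using Real.rpow_sum_le_const_mul_sum_rpow Finset.univ (fun i => d i x) hq.le
    have h3 : (‖gradient u x‖ / bdist Ω x) ^ q * bdist Ω x ^ a =
        ‖gradient u x‖ ^ q * bdist Ω x ^ (a - q) := by
      rw [Real.div_rpow (norm_nonneg _) hδ.le, Real.rpow_sub hδ]; ring
    rw [← ENNReal.ofReal_sum_of_nonneg (fun i _ => by positivity),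
      ← ENNReal.ofReal_mul hA0.le, ← ENNReal.ofReal_mul (by positivity),
      ← ENNReal.ofReal_add (by positivity) (mul_nonneg (by positivity)
        (Finset.sum_nonneg fun i _ => by positivity)), ← Finset.sum_mul]
    apply ENNReal.ofReal_le_ofReal
    calc (hessNorm u x + ‖gradient u x‖ / bdist Ω x) ^ q * bdist Ω x ^ a
        ≤ A * (hessNorm u x ^ q + (‖gradient u x‖ / bdist Ω x) ^ q) * bdist Ω x ^ a := by gcongr
      _ = A * (hessNorm u x ^ q * bdist Ω x ^ a) +
          A * (‖gradient u x‖ ^ q * bdist Ω x ^ (a - q)) := by rw [← h3]; ring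
      _ ≤ A * (hessNorm u x ^ q * bdist Ω x ^ a) +
          A * ((N * ∑ i, |d i x| ^ q) * bdist Ω x ^ (a - q)) := by gcongr
      _ = _ := by ring
  have hi : ∀ i, ∫⁻ x in Ω, ENNReal.ofReal (|d i x| ^ q * bdist Ω x ^ (a - q)) ≤
      ENNReal.ofReal C * H := by
    intro i
    refine (hC' _ (hu.partialDeriv i)).trans ?_
    gcongr
    refine setLIntegral_mono' hΩ.isOpen.measurableSet fun x hx => ENNReal.ofReal_le_ofReal ?_
    have hδ := bdist_pos hΩ.isOpen hne hx
    have := norm_fderiv_partial_le_hessNorm u x i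
    gcongr
  calc ∫⁻ x in Ω, ENNReal.ofReal
          ((hessNorm u x + ‖gradient u x‖ / bdist Ω x) ^ q * bdist Ω x ^ a)
      ≤ ∫⁻ x in Ω, (ENNReal.ofReal A * ENNReal.ofReal (hessNorm u x ^ q * bdist Ω x ^ a) +
        ENNReal.ofReal (A * N) *
          ∑ i, ENNReal.ofReal (|d i x| ^ q * bdist Ω x ^ (a - q))) :=
        setLIntegral_mono' hΩ.isOpen.measurableSet hpt
    _ = ENNReal.ofReal A * H + ENNReal.ofReal (A * N) *
          ∑ i, ∫⁻ x in Ω, ENNReal.ofReal (|d i x| ^ q * bdist Ω x ^ (a - q)) := by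
        rw [lintegral_add_left (hmeasH.const_mul _), lintegral_const_mul' _ _ ENNReal.ofReal_ne_top,
          lintegral_const_mul' _ _ ENNReal.ofReal_ne_top, lintegral_finsetSum _ fun i _ => hmeas i]
    _ ≤ ENNReal.ofReal A * H + ENNReal.ofReal (A * N) * ∑ _i : Fin n, ENNReal.ofReal C * H := by
        gcongr with i _
        exact hi i
    _ = _ := by
        rw [Finset.sum_const, Finset.card_univ, Fintype.card_fin, nsmul_eq_mul,
          ENNReal.ofReal_add hA0.le (by positivity), ENNReal.ofReal_mul (p := A * N) (by positivity),
          ENNReal.ofReal_mul (p := (n : ℝ)) (by positivity), ENNReal.ofReal_natCast]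
        ring

/-- The modular of the gradient, over the support of `u`, after absorption. The regularization of
the gradient is removed by dominated convergence. -/
lemma IsTestFunction.integral_modular_gradient_le {n : ℕ} {Ω : Set (Euc n)} (hΩ : IsOpen Ω)
    (hne : (frontier Ω).Nonempty) {u : Euc n → ℝ} (hu : IsTestFunction Ω u) {q a : ℝ}
    (hq : 1 < q) {M Q : ℝ → ℝ} {C c₀ : ℝ} (hMc : ContinuousOn M (Ici 0)) (hMz : M 0 = 0)
    (hM0 : ∀ s, 0 ≤ s → 0 ≤ M s) (hM1 : ContDiffOn ℝ 1 M (Ioi 0)) (hC : 0 ≤ C)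
    (hM' : ∀ s, 0 < s → |deriv M s| * s ≤ C * M s) (hQc : ContinuousOn Q (Ici 0))
    (hQ0 : ∀ s, 0 ≤ s → 0 ≤ Q s) (hc₀ : 0 ≤ c₀)
    (hMQ : ∀ s v w : ℝ, 0 < s → 0 < v → 0 < w →
      M s / s ^ 2 * (v * w) ≤ M s + c₀ * v ^ q + Q w) {t : ℝ} (ht : 0 < t) :
    ∫ x in tsupport u, M ‖gradient u x‖ * bdist Ω x ^ a ≤
      ∫ x in tsupport u, (c₀ * (2 * n * (3 + C + |a|) * t *
        (hessNorm u x + ‖gradient u x‖ / bdist Ω x)) ^ q + Q (|u x| / t)) * bdist Ω x ^ a := by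
  have hq0 : 0 < q := by linarith
  set K := tsupport u with hKdef
  have hK : IsCompact K := hu.hasCompactSupport
  have hKm : MeasurableSet K := hK.isClosed.measurableSet
  have hKΩ : K ⊆ Ω := hu.tsupport_subset
  have hδ : ∀ x ∈ K, 0 < bdist Ω x := fun x hx => bdist_pos hΩ hne (hKΩ hx)
  have hδc : ContinuousOn (fun x => bdist Ω x ^ a) K :=
    (continuous_bdist Ω).continuousOn.rpow_const fun x hx => Or.inl (hδ x hx).ne'
  have hδa : ∀ x ∈ K, 0 < bdist Ω x ^ a := fun x hx => Real.rpow_pos_of_pos (hδ x hx) a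
  have hgrc := hu.continuous_gradient
  set V : Euc n → ℝ := fun x => hessNorm u x + ‖gradient u x‖ / bdist Ω x with hV
  have hVc : ContinuousOn V K := hu.continuous_hessNorm.continuousOn.add
    (hgrc.norm.continuousOn.div (continuous_bdist Ω).continuousOn fun x hx => (hδ x hx).ne')
  have hV0 : ∀ x ∈ K, 0 ≤ V x := fun x hx => by
    have := hessNorm_nonneg u x; have := hδ x hx; simp only [hV]; positivity
  set B : ℝ := 2 * n * (3 + C + |a|) with hB
  have hB0 : 0 ≤ B := by positivity
  set m : ℝ → ℝ := fun s => M s / s ^ 2 with hm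
  have hm1 : ContDiffOn ℝ 1 m (Ioi 0) :=
    hM1.div (contDiffOn_id.pow 2) fun s hs => (pow_pos hs 2).ne'
  have hm0 : ∀ s, 0 < s → 0 ≤ m s := fun s hs => div_nonneg (hM0 s hs.le) (by positivity)
  have hm' : ∀ s, 0 < s → |deriv m s| * s ≤ (2 + C) * m s := by
    intro s hs
    have h1 : HasDerivAt M (deriv M s) s :=
      ((hM1.contDiffAt (Ioi_mem_nhds hs)).differentiableAt one_ne_zero).hasDerivAt
    have h2 := h1.fun_div (hasDerivAt_pow 2 s) (by positivity)
    have h3 : deriv m s * s = deriv M s * s / s ^ 2 - 2 * m s := by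
      simp only [hm]
      rw [h2.deriv]
      field_simp
      ring
    have h4 : |deriv M s * s / s ^ 2| ≤ C * m s := by
      rw [abs_div, abs_mul, abs_of_pos hs, abs_of_pos (by positivity : 0 < s ^ 2), hm,
        ← mul_div_assoc]
      exact div_le_div_of_nonneg_right (hM' s hs) (by positivity)
    have h5 := hm0 s hs
    calc |deriv m s| * s = |deriv m s * s| := by rw [abs_mul, abs_of_pos hs]
      _ ≤ |deriv M s * s / s ^ 2| + |2 * m s| := by rw [h3]; exact abs_sub _ _
      _ ≤ C * m s + 2 * m s := by
        gcongr
        rw [abs_of_nonneg (by positivity)]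
      _ = _ := by ring
  have hMQ0 : ∀ s v w : ℝ, 0 < s → 0 ≤ v → 0 ≤ w → m s * (v * w) ≤ M s + c₀ * v ^ q + Q w := by
    intro s v w hs hv hw
    have h1 := hM0 s hs.le
    have h2 := hQ0 w hw
    have h3 : 0 ≤ c₀ * v ^ q := by positivity
    rcases hv.eq_or_lt with rfl | hv
    · simp only [zero_mul, mul_zero]; linarith
    rcases hw.eq_or_lt with rfl | hw
    · simp only [mul_zero]; linarith
    exact hMQ s v w hs hv hw
  have hic : ∀ F : Euc n → ℝ, ContinuousOn F K → IntegrableOn F K := fun F hF =>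
    hF.integrableOn_compact hK
  have hMcomp : ∀ F : Euc n → ℝ, Continuous F → (∀ x, 0 ≤ F x) → Continuous fun x => M (F x) :=
    fun F hF h0 => hMc.comp_continuous hF h0
  set X : Euc n → ℝ := fun x => (c₀ * (B * t * V x) ^ q + Q (|u x| / t)) * bdist Ω x ^ a with hX
  have hQuc : Continuous fun x => Q (|u x| / t) :=
    hQc.comp_continuous (hu.contDiff_one.continuous.abs.div_const t) fun x => by
      simp only [mem_Ici]; positivity
  have hXc : ContinuousOn X K := ((continuousOn_const.mul ((continuousOn_const.mul hVc).rpow_const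
    fun _ _ => Or.inr hq0.le)).add hQuc.continuousOn).mul hδc
  have hXi := hic X hXc
  -- the inequality for the regularized gradient
  have hreg : ∀ ε : ℝ, 0 < ε →
      ∫ x in K, ‖gradient u x‖ ^ 2 * m (gradReg ε u x) * bdist Ω x ^ a ≤
        1 / 2 * (∫ x in K, M (gradReg ε u x) * bdist Ω x ^ a) + 1 / 2 * ∫ x in K, X x := by
    intro ε hε
    have hs0 := gradReg_pos hε u
    have hsc := (hu.contDiff_gradReg hε).continuous
    have hmsc : Continuous fun x => m (gradReg ε u x) :=
      (hMcomp _ hsc fun x => (hs0 x).le).div (hsc.pow 2) fun x => (pow_pos (hs0 x) 2).ne'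
    have hMsc := hMcomp _ hsc fun x => (hs0 x).le
    have hsum : ∫ x in K, ‖gradient u x‖ ^ 2 * m (gradReg ε u x) * bdist Ω x ^ a =
        ∑ i, ∫ x in K, fderiv ℝ u x (EuclideanSpace.single i 1) ^ 2 * m (gradReg ε u x) *
          bdist Ω x ^ a := by
      rw [← integral_finsetSum]
      · simp only [norm_gradient_sq, Finset.sum_mul]
      · intro i _
        exact hic _ ((((hu.partialDeriv i).contDiff_one.continuous.pow 2).mul
          hmsc).continuousOn.mul hδc)
    have hle := Finset.sum_le_sum fun (i : Fin n) (_ : i ∈ Finset.univ) =>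
      hu.integral_partial_sq_mul_le hΩ hne hε a (by linarith : 0 ≤ 2 + C) hm1 hm0 hm' i
    rw [← hsum, Finset.sum_const, Finset.card_univ, Fintype.card_fin, nsmul_eq_mul,
      ← integral_const_mul] at hle
    refine hle.trans ?_
    have hMi : IntegrableOn (fun x => M (gradReg ε u x) * bdist Ω x ^ a) K :=
      hic _ (hMsc.continuousOn.mul hδc)
    rw [← integral_const_mul, ← integral_const_mul,
      ← integral_add (hMi.const_mul _) (hXi.const_mul _)]
    refine setIntegral_mono_on (hic _ ?_) ((hMi.const_mul _).add (hXi.const_mul _)) hKm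
      fun x hx => ?_
    · exact continuousOn_const.mul ((continuousOn_const.mul
        ((hu.contDiff_one.continuous.abs.mul hmsc).continuousOn.mul hVc)).mul hδc)
    · have h1 := hMQ0 (gradReg ε u x) (B * t * V x) (|u x| / t) (hs0 x)
        (mul_nonneg (by positivity) (hV0 x hx)) (by positivity)
      have h2 : m (gradReg ε u x) * (B * t * V x * (|u x| / t)) =
          B * (|u x| * m (gradReg ε u x) * V x) := by field_simp
      rw [h2] at h1
      have h3 := mul_le_mul_of_nonneg_right h1 (hδa x hx).le
      have h4 : (n : ℝ) * ((1 + (2 + C) + |a|) * (|u x| * m (gradReg ε u x) *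
          (hessNorm u x + ‖gradient u x‖ / bdist Ω x)) * bdist Ω x ^ a) =
          1 / 2 * (B * (|u x| * m (gradReg ε u x) * V x) * bdist Ω x ^ a) := by
        simp only [hB, hV]; ring
      rw [h4]
      simp only [hX]
      linarith
  -- removal of the regularization
  obtain ⟨G, hG⟩ := hK.exists_bound_of_continuousOn hgrc.continuousOn
  set S : ℝ := Real.sqrt (1 + G ^ 2) with hS
  obtain ⟨Mb, hMb⟩ := isCompact_Icc.exists_bound_of_continuousOn
    (hMc.mono (Icc_subset_Ici_self : Icc 0 S ⊆ Ici 0))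
  have hMbb : ∀ ε : ℝ, 0 < ε → ε < 1 → ∀ x ∈ K, M (gradReg ε u x) ≤ Mb := by
    intro ε hε hε1 x hx
    refine (le_abs_self _).trans (hMb _ ⟨(gradReg_pos hε u x).le, ?_⟩)
    refine Real.sqrt_le_sqrt (add_le_add (by nlinarith) ?_)
    exact pow_le_pow_left₀ (norm_nonneg _) (hG x hx) 2
  have hMbi : IntegrableOn (fun x => Mb * bdist Ω x ^ a) K :=
    hic _ (continuousOn_const.mul hδc)
  have hslim : ∀ x, Tendsto (fun ε => gradReg ε u x) (𝓝[>] 0) (𝓝[≥] ‖gradient u x‖) := by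
    intro x
    refine tendsto_nhdsWithin_iff.2 ⟨?_, .of_forall fun ε => norm_gradient_le_gradReg ε u x⟩
    have : Continuous fun ε => gradReg ε u x := by unfold gradReg; fun_prop
    have h0 := (this.tendsto 0).mono_left (nhdsWithin_le_nhds (s := Ioi 0))
    simpa [gradReg] using h0
  have hMlim : ∀ x, Tendsto (fun ε => M (gradReg ε u x)) (𝓝[>] 0) (𝓝 (M ‖gradient u x‖)) :=
    fun x => ((hMc _ (norm_nonneg _)).mono
      (Ici_subset_Ici.2 (norm_nonneg (gradient u x)))).tendsto.comp (hslim x)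
  have hev : ∀ᶠ ε : ℝ in 𝓝[>] 0, 0 < ε ∧ ε < 1 := Ioo_mem_nhdsGT one_pos
  have hlimR : Tendsto (fun ε => ∫ x in K, M (gradReg ε u x) * bdist Ω x ^ a) (𝓝[>] 0)
      (𝓝 (∫ x in K, M ‖gradient u x‖ * bdist Ω x ^ a)) := by
    refine tendsto_integral_filter_of_dominated_convergence (fun x => Mb * bdist Ω x ^ a) ?_ ?_
      hMbi ?_
    · filter_upwards [hev] with ε hε
      exact (hic _ ((hMcomp _ (hu.contDiff_gradReg hε.1).continuous
        fun x => (gradReg_pos hε.1 u x).le).continuousOn.mul hδc)).aestronglyMeasurable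
    · filter_upwards [hev] with ε hε
      rw [ae_restrict_iff' hKm]
      refine .of_forall fun x hx => ?_
      have h1 := hM0 _ (gradReg_pos hε.1 u x).le
      have h2 := hδa x hx
      rw [Real.norm_of_nonneg (by positivity)]
      exact mul_le_mul_of_nonneg_right (hMbb ε hε.1 hε.2 x hx) h2.le
    · exact .of_forall fun x => (hMlim x).mul_const _
  have hlimL : Tendsto (fun ε => ∫ x in K, ‖gradient u x‖ ^ 2 * m (gradReg ε u x) * bdist Ω x ^ a)
      (𝓝[>] 0) (𝓝 (∫ x in K, M ‖gradient u x‖ * bdist Ω x ^ a)) := by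
    refine tendsto_integral_filter_of_dominated_convergence (fun x => Mb * bdist Ω x ^ a) ?_ ?_
      hMbi ?_
    · filter_upwards [hev] with ε hε
      have hsc := (hu.contDiff_gradReg hε.1).continuous
      have hmsc : Continuous fun x => m (gradReg ε u x) :=
        (hMcomp _ hsc fun x => (gradReg_pos hε.1 u x).le).div (hsc.pow 2)
          fun x => (pow_pos (gradReg_pos hε.1 u x) 2).ne'
      exact (hic _ (((hgrc.norm.pow 2).mul hmsc).continuousOn.mul hδc)).aestronglyMeasurable
    · filter_upwards [hev] with ε hε
      rw [ae_restrict_iff' hKm]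
      refine .of_forall fun x hx => ?_
      have hs := gradReg_pos hε.1 u x
      have h1 := hM0 _ hs.le
      have h2 := hδa x hx
      have h3 := hm0 _ hs
      rw [Real.norm_of_nonneg (by positivity)]
      refine mul_le_mul_of_nonneg_right (le_trans ?_ (hMbb ε hε.1 hε.2 x hx)) h2.le
      have h4 : ‖gradient u x‖ ^ 2 ≤ gradReg ε u x ^ 2 :=
        pow_le_pow_left₀ (norm_nonneg _) (norm_gradient_le_gradReg ε u x) 2
      calc ‖gradient u x‖ ^ 2 * m (gradReg ε u x) ≤ gradReg ε u x ^ 2 * m (gradReg ε u x) := by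
            gcongr
        _ = M (gradReg ε u x) := by simp only [hm]; field_simp
    · refine .of_forall fun x => Tendsto.mul_const _ ?_
      rcases (norm_nonneg (gradient u x)).eq_or_lt with h0 | h0
      · rw [← h0, hMz]
        simp
      · have h1 := (hslim x).mono_right nhdsWithin_le_nhds
        have h2 := ((hMlim x).div (h1.pow 2) (by positivity)).const_mul (‖gradient u x‖ ^ 2)
        rwa [mul_div_cancel₀ _ (by positivity : ‖gradient u x‖ ^ 2 ≠ 0)] at h2
  have hfin := le_of_tendsto_of_tendsto hlimL
    ((hlimR.const_mul (1 / 2)).add_const (1 / 2 * ∫ x in K, X x))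
    (by filter_upwards [self_mem_nhdsWithin] with ε hε using hreg ε hε)
  linarith

/-- **The modular inequality for the gradient.** The parameter `t` reflects the invariance of the
structural condition on `M` and `Q` under `(v, w) ↦ (t * v, w / t)`; it is what allows a
multiplicative form of the inequality to be deduced. -/
theorem exists_modular_gradient_le {n : ℕ} (hn : 1 ≤ n) {Ω : Set (Euc n)}
    (hΩ : IsBoundedLipschitzDomain Ω) {q a : ℝ} (hq : 1 < q) (ha : a < q - 1) {M Q : ℝ → ℝ}
    {C c₀ : ℝ} (hMc : ContinuousOn M (Ici 0)) (hMz : M 0 = 0)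
    (hM0 : ∀ s, 0 ≤ s → 0 ≤ M s) (hM1 : ContDiffOn ℝ 1 M (Ioi 0)) (hC : 0 ≤ C)
    (hM' : ∀ s, 0 < s → |deriv M s| * s ≤ C * M s) (hQc : ContinuousOn Q (Ici 0))
    (hQ0 : ∀ s, 0 ≤ s → 0 ≤ Q s) (hc₀ : 0 ≤ c₀)
    (hMQ : ∀ s v w : ℝ, 0 < s → 0 < v → 0 < w →
      M s / s ^ 2 * (v * w) ≤ M s + c₀ * v ^ q + Q w) :
    ∃ c : ℝ, 0 < c ∧ ∀ u : Euc n → ℝ, IsTestFunction Ω u → ∀ t : ℝ, 0 < t →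
      ∫⁻ x in Ω, ENNReal.ofReal (M ‖gradient u x‖ * bdist Ω x ^ a) ≤ ENNReal.ofReal c *
        (ENNReal.ofReal (t ^ q) * (∫⁻ x in Ω, ENNReal.ofReal (hessNorm u x ^ q * bdist Ω x ^ a)) +
          ∫⁻ x in Ω, ENNReal.ofReal (Q (|u x| / t) * bdist Ω x ^ a)) := by
  have hq0 : 0 < q := by linarith
  have hne := hΩ.frontier_nonempty hn
  obtain ⟨C₁, hC₁, hC₁'⟩ := exists_hardy_gradient hn hΩ hq ha
  set B : ℝ := 2 * n * (3 + C + |a|) with hB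
  have hB0 : 0 ≤ B := by positivity
  refine ⟨c₀ * B ^ q * C₁ + 1, by positivity, fun u hu t ht => ?_⟩
  set K := tsupport u with hKdef
  have hK : IsCompact K := hu.hasCompactSupport
  have hKm : MeasurableSet K := hK.isClosed.measurableSet
  have hKΩ : K ⊆ Ω := hu.tsupport_subset
  have hδ : ∀ x ∈ K, 0 < bdist Ω x := fun x hx => bdist_pos hΩ.isOpen hne (hKΩ hx)
  have hδc : ContinuousOn (fun x => bdist Ω x ^ a) K :=
    (continuous_bdist Ω).continuousOn.rpow_const fun x hx => Or.inl (hδ x hx).ne'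
  have hmain := hu.integral_modular_gradient_le (a := a) hΩ.isOpen hne hq hMc hMz hM0 hM1 hC hM'
    hQc hQ0 hc₀ hMQ ht
  rw [← hB] at hmain
  set V : Euc n → ℝ := fun x => hessNorm u x + ‖gradient u x‖ / bdist Ω x with hV
  have hVc : ContinuousOn V K := hu.continuous_hessNorm.continuousOn.add
    (hu.continuous_gradient.norm.continuousOn.div (continuous_bdist Ω).continuousOn
      fun x hx => (hδ x hx).ne')
  have hV0 : ∀ x ∈ K, 0 ≤ V x := fun x hx => by
    have := hessNorm_nonneg u x; have := hδ x hx; simp only [hV]; positivity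
  have hQu : Continuous fun x => Q (|u x| / t) :=
    hQc.comp_continuous (hu.contDiff_one.continuous.abs.div_const t) fun x => by
      simp only [mem_Ici]; positivity
  set H := ∫⁻ x in Ω, ENNReal.ofReal (hessNorm u x ^ q * bdist Ω x ^ a) with hH
  have hMi : IntegrableOn (fun x => M ‖gradient u x‖ * bdist Ω x ^ a) K :=
    ((hMc.comp_continuous hu.continuous_gradient.norm fun x =>
      norm_nonneg _).continuousOn.mul hδc).integrableOn_compact hK
  have hXi : IntegrableOn (fun x => (c₀ * (B * t * V x) ^ q + Q (|u x| / t)) * bdist Ω x ^ a) K :=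
    (((continuousOn_const.mul ((continuousOn_const.mul hVc).rpow_const
      fun _ _ => Or.inr hq0.le)).add hQu.continuousOn).mul hδc).integrableOn_compact hK
  have hQm : Measurable fun x => ENNReal.ofReal (Q (|u x| / t) * bdist Ω x ^ a) := by
    exact (hQu.measurable.mul ((continuous_bdist Ω).measurable.pow_const a)).ennreal_ofReal
  calc ∫⁻ x in Ω, ENNReal.ofReal (M ‖gradient u x‖ * bdist Ω x ^ a)
      ≤ ∫⁻ x in K, ENNReal.ofReal (M ‖gradient u x‖ * bdist Ω x ^ a) := by
        rw [← lintegral_indicator hΩ.isOpen.measurableSet, ← lintegral_indicator hKm]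
        refine lintegral_mono fun x => ?_
        by_cases hxK : x ∈ K
        · rw [indicator_of_mem hxK, indicator_of_mem (hKΩ hxK)]
        · rw [indicator_of_notMem hxK]
          refine (indicator_apply_eq_zero.2 fun _ => ?_).le
          rw [IsTestFunction.gradient_eq_zero hxK, norm_zero, hMz, zero_mul, ENNReal.ofReal_zero]
    _ = ENNReal.ofReal (∫ x in K, M ‖gradient u x‖ * bdist Ω x ^ a) := by
        refine (ofReal_integral_eq_lintegral_ofReal hMi
          ((ae_restrict_iff' hKm).2 (.of_forall fun x hx => ?_))).symm
        exact mul_nonneg (hM0 _ (norm_nonneg _)) (Real.rpow_nonneg (hδ x hx).le a)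
    _ ≤ ENNReal.ofReal
          (∫ x in K, (c₀ * (B * t * V x) ^ q + Q (|u x| / t)) * bdist Ω x ^ a) :=
        ENNReal.ofReal_le_ofReal hmain
    _ = ∫⁻ x in K, ENNReal.ofReal
          ((c₀ * (B * t * V x) ^ q + Q (|u x| / t)) * bdist Ω x ^ a) := by
        refine ofReal_integral_eq_lintegral_ofReal hXi
          ((ae_restrict_iff' hKm).2 (.of_forall fun x hx => ?_))
        have h1 := hQ0 (|u x| / t) (by positivity)
        have h2 := hV0 x hx
        have h3 := hδ x hx
        positivity
    _ = ∫⁻ x in K, (ENNReal.ofReal (c₀ * B ^ q * t ^ q) * ENNReal.ofReal (V x ^ q * bdist Ω x ^ a) +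
          ENNReal.ofReal (Q (|u x| / t) * bdist Ω x ^ a)) := by
        refine setLIntegral_congr_fun hKm fun x hx => ?_
        have h1 := hQ0 (|u x| / t) (by positivity)
        have h2 := hV0 x hx
        have h3 := hδ x hx
        rw [← ENNReal.ofReal_mul (by positivity), ← ENNReal.ofReal_add (by positivity)
          (by positivity), Real.mul_rpow (by positivity) h2, Real.mul_rpow hB0 ht.le]
        congr 1
        ring
    _ = ENNReal.ofReal (c₀ * B ^ q * t ^ q) * (∫⁻ x in K, ENNReal.ofReal (V x ^ q * bdist Ω x ^ a)) +
          ∫⁻ x in K, ENNReal.ofReal (Q (|u x| / t) * bdist Ω x ^ a) := by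
        rw [lintegral_add_right _ hQm, lintegral_const_mul' _ _ ENNReal.ofReal_ne_top]
    _ ≤ ENNReal.ofReal (c₀ * B ^ q * t ^ q) * (ENNReal.ofReal C₁ * H) +
          ∫⁻ x in Ω, ENNReal.ofReal (Q (|u x| / t) * bdist Ω x ^ a) := by
        gcongr
        exact (lintegral_mono_set hKΩ).trans (hC₁' u hu)
    _ = ENNReal.ofReal (c₀ * B ^ q * C₁) * (ENNReal.ofReal (t ^ q) * H) +
          1 * ∫⁻ x in Ω, ENNReal.ofReal (Q (|u x| / t) * bdist Ω x ^ a) := by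
        rw [one_mul, ENNReal.ofReal_mul (p := c₀ * B ^ q) (by positivity),
          ENNReal.ofReal_mul (p := c₀ * B ^ q) (by positivity)]
        ring
    _ ≤ _ := by
        rw [ENNReal.ofReal_add (by positivity) zero_le_one, ENNReal.ofReal_one, mul_add]
        gcongr
        · exact le_self_add
        · exact le_add_self

/-! ### `N`-functions -/

namespace IsNFunction

variable {M : ℝ → ℝ}

lemma apply_zero (hM : IsNFunction M) : M 0 = 0 := by
  have h1 : Tendsto M (𝓝[>] 0) (𝓝 (M 0)) :=
    ((hM.continuousOn 0 self_mem_Ici).mono Ioi_subset_Ici_self).tendsto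
  have h2 : Tendsto (fun t => M t / t * t) (𝓝[>] 0) (𝓝 (0 * 0)) :=
    hM.tendsto_zero.mul (tendsto_id.mono_left nhdsWithin_le_nhds)
  rw [zero_mul] at h2
  refine tendsto_nhds_unique h1 (h2.congr' ?_)
  filter_upwards [self_mem_nhdsWithin] with t ht
  exact div_mul_cancel₀ _ (ne_of_gt ht)

lemma apply_mul_le (hM : IsNFunction M) {s x : ℝ} (hs : 0 ≤ s) (hs1 : s ≤ 1) (hx : 0 ≤ x) :
    M (s * x) ≤ s * M x := by
  have := hM.convexOn.2 (show x ∈ Ici 0 from hx) self_mem_Ici hs (sub_nonneg.2 hs1)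
    (add_sub_cancel s 1)
  simpa [hM.apply_zero] using this

lemma mono (hM : IsNFunction M) {x y : ℝ} (hx : 0 ≤ x) (hxy : x ≤ y) : M x ≤ M y := by
  rcases (hx.trans hxy).eq_or_lt with hy | hy
  · rw [show x = y by linarith]
  · have h := hM.apply_mul_le (s := x / y) (by positivity) ((div_le_one hy).2 hxy) hy.le
    rw [div_mul_cancel₀ _ hy.ne'] at h
    exact h.trans (mul_le_of_le_one_left (hM.nonneg y hy.le) ((div_le_one hy).2 hxy))

end IsNFunction

/-- Comparison of the tangent slope at `s` with the chords over `[0, s]` and `[s, 2 * s]`. -/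
lemma ConditionM.exists_abs_deriv_mul_le {M : ℝ → ℝ} (hM : ConditionM M) :
    ∃ C : ℝ, 0 ≤ C ∧ ∀ s, 0 < s → |deriv M s| * s ≤ C * M s := by
  obtain ⟨D, hD, hD'⟩ := hM.delta_two
  have hN := hM.isNFunction
  refine ⟨D, hD.le, fun s hs => ?_⟩
  have h1 : HasDerivAt M (deriv M s) s :=
    ((hM.contDiffOn.contDiffAt (Ioi_mem_nhds hs)).differentiableAt one_ne_zero).hasDerivAt
  have hs0 : s ∈ Ici (0 : ℝ) := hs.le
  have h2 := hN.convexOn.slope_le_of_hasDerivAt self_mem_Ici hs0 hs h1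
  have h3 := hN.convexOn.le_slope_of_hasDerivAt hs0
    (show 2 * s ∈ Ici (0 : ℝ) by simp only [mem_Ici]; positivity) (by linarith) h1
  have h4 := hN.nonneg s hs.le
  rw [slope_def_field, hN.apply_zero, sub_zero, sub_zero] at h2
  have h5 : 0 ≤ deriv M s := le_trans (by positivity) h2
  rw [slope_def_field, show 2 * s - s = s by ring, le_div_iff₀ hs] at h3
  rw [abs_of_nonneg h5]
  linarith [hD' s hs]

/-! ### Multiplicative inequalities by scaling -/

namespace IsTestFunction

variable {n : ℕ} {Ω : Set (Euc n)} {u : Euc n → ℝ}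

lemma fderiv_const_mul (hu : IsTestFunction Ω u) (c : ℝ) (x : Euc n) :
    fderiv ℝ (fun y => c * u y) x = c • fderiv ℝ u x :=
  _root_.fderiv_const_mul (hu.contDiff_one.differentiable one_ne_zero x) c

lemma norm_gradient_const_mul (hu : IsTestFunction Ω u) (c : ℝ) (x : Euc n) :
    ‖gradient (fun y => c * u y) x‖ = |c| * ‖gradient u x‖ := by
  rw [norm_gradient, norm_gradient, hu.fderiv_const_mul, norm_smul, Real.norm_eq_abs]

lemma hessNorm_const_mul (hu : IsTestFunction Ω u) (c : ℝ) (x : Euc n) :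
    hessNorm (fun y => c * u y) x = |c| * hessNorm u x := by
  have h : ∀ i j, secondPartial (fun y => c * u y) i j x = c * secondPartial u i j x := by
    intro i j
    simp only [secondPartial, hu.fderiv_const_mul, smul_apply, smul_eq_mul]
    rw [(hu.partialDeriv i).fderiv_const_mul, smul_apply, smul_eq_mul]
  simp only [hessNorm, h, mul_pow, ← Finset.mul_sum]
  rw [Real.sqrt_mul (sq_nonneg c), Real.sqrt_sq_eq_abs]

/-- A continuous function that vanishes off the support of a test function is integrable against any
power of the distance to the boundary. -/
lemma lintegral_lt_top (hΩ : IsOpen Ω) (hne : (frontier Ω).Nonempty) (hu : IsTestFunction Ω u)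
    (a : ℝ) {F : Euc n → ℝ} (hF : Continuous F) (hF0 : ∀ x, x ∉ tsupport u → F x = 0) :
    ∫⁻ x in Ω, ENNReal.ofReal (F x * bdist Ω x ^ a) < ⊤ := by
  have hK : IsCompact (tsupport u) := hu.hasCompactSupport
  have hKm := hK.isClosed.measurableSet
  have hc : ContinuousOn (fun x => F x * bdist Ω x ^ a) (tsupport u) :=
    hF.continuousOn.mul ((continuous_bdist Ω).continuousOn.rpow_const fun x hx =>
      Or.inl (bdist_pos hΩ hne (hu.tsupport_subset hx)).ne')
  refine lt_of_le_of_lt ?_ (hc.integrableOn_compact hK (μ := volume)).lintegral_lt_top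
  rw [← lintegral_indicator hΩ.measurableSet, ← lintegral_indicator hKm]
  refine lintegral_mono fun x => ?_
  by_cases hxK : x ∈ tsupport u
  · rw [indicator_of_mem hxK, indicator_of_mem (hu.tsupport_subset hxK)]
  · rw [indicator_of_notMem hxK]
    refine (indicator_apply_eq_zero.2 fun _ => ?_).le
    rw [hF0 x hxK, zero_mul, ENNReal.ofReal_zero]

lemma hessNorm_eq_zero {x : Euc n} (hx : x ∉ tsupport u) : hessNorm u x = 0 := by
  have h : ∀ i j, secondPartial u i j x = 0 := fun i j => by
    have : x ∉ tsupport (fun y => fderiv ℝ u y (EuclideanSpace.single i 1)) := fun h =>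
      hx (tsupport_fderiv_apply_subset ℝ _ h)
    have h0 : fderiv ℝ (fun y => fderiv ℝ u y (EuclideanSpace.single i 1)) x = 0 :=
      image_eq_zero_of_notMem_tsupport fun h => this (tsupport_fderiv_subset ℝ h)
    rw [secondPartial, h0, zero_apply]
  simp [hessNorm, h]

end IsTestFunction

/-- A modular inequality with parameter, applied to `u / √(b * b')`, where `b` and `b'` dominate the
norms of the second derivatives and of `u`. -/
lemma modular_gradient_div_sqrt_le {n : ℕ} {Ω : Set (Euc n)} {q a c : ℝ} (hc : 0 < c)
    {M Q : ℝ → ℝ}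
    (h : ∀ u : Euc n → ℝ, IsTestFunction Ω u → ∀ t : ℝ, 0 < t →
      ∫⁻ x in Ω, ENNReal.ofReal (M ‖gradient u x‖ * bdist Ω x ^ a) ≤ ENNReal.ofReal c *
        (ENNReal.ofReal (t ^ q) * (∫⁻ x in Ω, ENNReal.ofReal (hessNorm u x ^ q * bdist Ω x ^ a)) +
          ∫⁻ x in Ω, ENNReal.ofReal (Q (|u x| / t) * bdist Ω x ^ a)))
    {u : Euc n → ℝ} (hu : IsTestFunction Ω u) {b b' : ℝ} (hb : 0 < b) (hb' : 0 < b')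
    (hH : ∫⁻ x in Ω, ENNReal.ofReal (hessNorm u x ^ q * bdist Ω x ^ a) ≤ ENNReal.ofReal (b ^ q))
    (hU : ∫⁻ x in Ω, ENNReal.ofReal (Q (|u x| / b') * bdist Ω x ^ a) ≤ 1) :
    ∫⁻ x in Ω, ENNReal.ofReal (M (‖gradient u x‖ / Real.sqrt (b * b')) * bdist Ω x ^ a) ≤
      ENNReal.ofReal (2 * c) := by
  set k := Real.sqrt (b * b') with hk
  set t := Real.sqrt (b' / b) with ht
  have hk0 : 0 < k := Real.sqrt_pos.2 (by positivity)
  have ht0 : 0 < t := Real.sqrt_pos.2 (by positivity)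
  have hkt : k * t = b' := by
    rw [hk, ht, ← Real.sqrt_mul (by positivity), show b * b' * (b' / b) = b' ^ 2 by field_simp,
      Real.sqrt_sq hb'.le]
  have htk : t * k⁻¹ = b⁻¹ := by
    have h1 : t * b = k := by
      rw [hk, ht, ← Real.sqrt_sq hb.le, ← Real.sqrt_mul (by positivity), Real.sqrt_sq hb.le]
      congr 1; field_simp
    rw [← h1]; field_simp
  have hmain := h _ (hu.const_mul k⁻¹) t ht0
  have hka : |k⁻¹| = k⁻¹ := abs_of_pos (by positivity)
  have e1 : ∀ x, |k⁻¹ * u x| / t = |u x| / b' := fun x => by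
    rw [abs_mul, hka, ← hkt]; field_simp
  have e2 : ∀ x, hessNorm (fun y => k⁻¹ * u y) x ^ q * bdist Ω x ^ a =
      k⁻¹ ^ q * (hessNorm u x ^ q * bdist Ω x ^ a) := fun x => by
    rw [hu.hessNorm_const_mul, hka, Real.mul_rpow (by positivity) (hessNorm_nonneg u x), mul_assoc]
  have e3 : ∀ x, ‖gradient (fun y => k⁻¹ * u y) x‖ = ‖gradient u x‖ / k := fun x => by
    rw [hu.norm_gradient_const_mul, hka, inv_mul_eq_div]
  have e4 : ∫⁻ x in Ω, ENNReal.ofReal (k⁻¹ ^ q * (hessNorm u x ^ q * bdist Ω x ^ a)) =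
      ENNReal.ofReal (k⁻¹ ^ q) * ∫⁻ x in Ω, ENNReal.ofReal (hessNorm u x ^ q * bdist Ω x ^ a) := by
    rw [← lintegral_const_mul' _ _ ENNReal.ofReal_ne_top]
    simp only [ENNReal.ofReal_mul (show 0 ≤ k⁻¹ ^ q by positivity)]
  simp only [e1, e2, e3, e4] at hmain
  refine hmain.trans ?_
  have e5 : ENNReal.ofReal (t ^ q) * (ENNReal.ofReal (k⁻¹ ^ q) *
      ∫⁻ x in Ω, ENNReal.ofReal (hessNorm u x ^ q * bdist Ω x ^ a)) ≤ 1 := by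
    rw [← mul_assoc, ← ENNReal.ofReal_mul (by positivity), ← Real.mul_rpow ht0.le (by positivity),
      htk]
    calc _ ≤ ENNReal.ofReal (b⁻¹ ^ q) * ENNReal.ofReal (b ^ q) := by gcongr
      _ = 1 := by
        rw [← ENNReal.ofReal_mul (by positivity), ← Real.mul_rpow (by positivity) hb.le,
          inv_mul_cancel₀ hb.ne', Real.one_rpow, ENNReal.ofReal_one]
  calc _ ≤ ENNReal.ofReal c * (1 + 1) := by gcongr
    _ = ENNReal.ofReal (2 * c) := by
      rw [mul_comm 2 c, ENNReal.ofReal_mul hc.le, one_add_one_eq_two, ENNReal.ofReal_ofNat]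

/-- A bound by a product may be tested on strictly larger positive real factors. This covers the case
in which one of the factors vanishes, where no normalization is possible. -/
lemma le_mul_mul_of_forall_lt {X c β γ : ℝ≥0∞} (hc : c ≠ ⊤) (hβ : β ≠ ⊤) (hγ : γ ≠ ⊤)
    (h : ∀ b b' : ℝ, 0 < b → 0 < b' → β < ENNReal.ofReal b → γ < ENNReal.ofReal b' →
      X ≤ c * ENNReal.ofReal (b * b')) : X ≤ c * β * γ := by
  have hlim : Tendsto (fun η : ℝ => c * ENNReal.ofReal ((β.toReal + η) * (γ.toReal + η))) (𝓝[>] 0)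
      (𝓝 (c * ENNReal.ofReal ((β.toReal + 0) * (γ.toReal + 0)))) := by
    refine ENNReal.Tendsto.const_mul ?_ (Or.inr hc)
    have : Continuous fun η : ℝ => ENNReal.ofReal ((β.toReal + η) * (γ.toReal + η)) :=
      ENNReal.continuous_ofReal.comp (by fun_prop)
    exact (this.tendsto 0).mono_left nhdsWithin_le_nhds
  rw [add_zero, add_zero, ENNReal.ofReal_mul ENNReal.toReal_nonneg, ENNReal.ofReal_toReal hβ,
    ENNReal.ofReal_toReal hγ, ← mul_assoc] at hlim
  refine ge_of_tendsto hlim ?_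
  filter_upwards [self_mem_nhdsWithin] with η (hη : 0 < η)
  have hβ0 : 0 ≤ β.toReal := ENNReal.toReal_nonneg
  have hγ0 : 0 ≤ γ.toReal := ENNReal.toReal_nonneg
  refine h _ _ (by positivity) (by positivity) ?_ ?_
  · rw [ENNReal.lt_ofReal_iff_toReal_lt hβ]; linarith
  · rw [ENNReal.lt_ofReal_iff_toReal_lt hγ]; linarith

/-- The three-exponent Young inequality behind the power case. -/
lemma rpow_div_sq_mul_le {p q r : ℝ} (hp : 2 ≤ p) (hq : 1 < q) (hr : 1 < r)
    (hpqr : 2 / p = 1 / q + 1 / r) {s v w : ℝ} (hs : 0 < s) (hv : 0 < v) (hw : 0 < w) :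
    s ^ p / s ^ 2 * (v * w) ≤ s ^ p + 1 * v ^ q + w ^ r := by
  have hp0 : 0 < p := by linarith
  have hq0 : 0 < q := by linarith
  have hr0 : 0 < r := by linarith
  have hw1 : 0 ≤ (p - 2) / p := div_nonneg (by linarith) hp0.le
  have hsum : (p - 2) / p + 1 / q + 1 / r = 1 := by
    rw [sub_div, div_self hp0.ne', hpqr]; ring
  have h := Real.geom_mean_le_arith_mean3_weighted hw1 (by positivity : 0 ≤ 1 / q)
    (by positivity : 0 ≤ 1 / r) (by positivity : 0 ≤ s ^ p) (by positivity : 0 ≤ v ^ q)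
    (by positivity : 0 ≤ w ^ r) hsum
  rw [← Real.rpow_mul hs.le, ← Real.rpow_mul hv.le, ← Real.rpow_mul hw.le,
    mul_one_div_cancel hq0.ne', mul_one_div_cancel hr0.ne', Real.rpow_one, Real.rpow_one,
    mul_div_cancel₀ _ hp0.ne', Real.rpow_sub hs, Real.rpow_ofNat] at h
  have hq1 : 1 / q ≤ 1 := by rw [div_le_one hq0]; exact hq.le
  have hr1 : 1 / r ≤ 1 := by rw [div_le_one hr0]; exact hr.le
  have hp1 : (p - 2) / p ≤ 1 := by rw [div_le_one hp0]; linarith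
  have g1 := mul_le_of_le_one_left (by positivity : 0 ≤ s ^ p) hp1
  have g2 := mul_le_of_le_one_left (by positivity : 0 ≤ v ^ q) hq1
  have g3 := mul_le_of_le_one_left (by positivity : 0 ≤ w ^ r) hr1
  linarith

theorem exists_gradient_rpow_le {n : ℕ} (hn : 1 ≤ n) {Ω : Set (Euc n)}
    (hΩ : IsBoundedLipschitzDomain Ω) {q a : ℝ} (hq : 1 < q) (ha : a < q - 1) {p r : ℝ}
    (hp : 2 ≤ p) (hr : 1 < r) (hpqr : 2 / p = 1 / q + 1 / r) :
    ∃ c : ℝ, 0 < c ∧ ∀ u : Euc n → ℝ, IsTestFunction Ω u →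
      (∫⁻ x in Ω, ENNReal.ofReal (‖gradient u x‖ ^ p * bdist Ω x ^ a)) ^ (2 / p) ≤
        ENNReal.ofReal c *
          (∫⁻ x in Ω, ENNReal.ofReal (hessNorm u x ^ q * bdist Ω x ^ a)) ^ (1 / q) *
          (∫⁻ x in Ω, ENNReal.ofReal (|u x| ^ r * bdist Ω x ^ a)) ^ (1 / r) := by
  have hp0 : 0 < p := by linarith
  have hq0 : 0 < q := by linarith
  have hr0 : 0 < r := by linarith
  have hne := hΩ.frontier_nonempty hn
  obtain ⟨c, hc, hcore⟩ := exists_modular_gradient_le hn hΩ hq ha (M := fun s => s ^ p)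
    (Q := fun s => s ^ r) (C := p) (c₀ := 1)
    (continuousOn_id.rpow_const fun _ _ => Or.inr hp0.le) (Real.zero_rpow hp0.ne')
    (fun s hs => Real.rpow_nonneg hs p)
    (fun s hs => (Real.contDiffAt_rpow_const_of_ne (ne_of_gt hs)).contDiffWithinAt) hp0.le
    (fun s hs => by
      rw [(Real.hasDerivAt_rpow_const (Or.inl hs.ne')).deriv, abs_of_nonneg (by positivity),
        mul_assoc, ← Real.rpow_add_one hs.ne', sub_add_cancel])
    (continuousOn_id.rpow_const fun _ _ => Or.inr hr0.le) (fun s hs => Real.rpow_nonneg hs r)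
    zero_le_one (fun s v w hs hv hw => rpow_div_sq_mul_le hp hq hr hpqr hs hv hw)
  refine ⟨(2 * c) ^ (2 / p), by positivity, fun u hu => ?_⟩
  set H := ∫⁻ x in Ω, ENNReal.ofReal (hessNorm u x ^ q * bdist Ω x ^ a) with hH
  set U := ∫⁻ x in Ω, ENNReal.ofReal (|u x| ^ r * bdist Ω x ^ a) with hU
  have hHfin : H < ⊤ := hu.lintegral_lt_top hΩ.isOpen hne a
    (hu.continuous_hessNorm.rpow_const fun _ => Or.inr hq0.le) fun x hx => by
      rw [IsTestFunction.hessNorm_eq_zero hx, Real.zero_rpow hq0.ne']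
  have hUfin : U < ⊤ := hu.lintegral_lt_top hΩ.isOpen hne a
    (hu.contDiff_one.continuous.abs.rpow_const fun _ => Or.inr hr0.le) fun x hx => by
      rw [image_eq_zero_of_notMem_tsupport hx, abs_zero, Real.zero_rpow hr0.ne']
  refine le_mul_mul_of_forall_lt ENNReal.ofReal_ne_top
    (ENNReal.rpow_ne_top_of_nonneg (by positivity) hHfin.ne)
    (ENNReal.rpow_ne_top_of_nonneg (by positivity) hUfin.ne) fun b b' hb hb' hHb hUb => ?_
  have hHb' : H ≤ ENNReal.ofReal (b ^ q) := by
    rw [← ENNReal.ofReal_rpow_of_nonneg hb.le hq0.le]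
    rw [one_div] at hHb
    exact (ENNReal.rpow_inv_le_iff hq0).1 hHb.le
  have hUb' : U ≤ ENNReal.ofReal (b' ^ r) := by
    rw [← ENNReal.ofReal_rpow_of_nonneg hb'.le hr0.le]
    rw [one_div] at hUb
    exact (ENNReal.rpow_inv_le_iff hr0).1 hUb.le
  have hUb1 : ∫⁻ x in Ω, ENNReal.ofReal ((|u x| / b') ^ r * bdist Ω x ^ a) ≤ 1 := by
    have e : ∀ x, ENNReal.ofReal ((|u x| / b') ^ r * bdist Ω x ^ a) =
        ENNReal.ofReal ((b' ^ r)⁻¹) * ENNReal.ofReal (|u x| ^ r * bdist Ω x ^ a) := fun x => by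
      rw [← ENNReal.ofReal_mul (by positivity), Real.div_rpow (abs_nonneg _) hb'.le]
      congr 1; ring
    simp only [e]
    rw [lintegral_const_mul' _ _ ENNReal.ofReal_ne_top]
    calc _ ≤ ENNReal.ofReal ((b' ^ r)⁻¹) * ENNReal.ofReal (b' ^ r) := by gcongr
      _ = 1 := by
        rw [← ENNReal.ofReal_mul (by positivity), inv_mul_cancel₀ (by positivity),
          ENNReal.ofReal_one]
  have hmain : ∫⁻ x in Ω, ENNReal.ofReal ((‖gradient u x‖ / Real.sqrt (b * b')) ^ p *
      bdist Ω x ^ a) ≤ ENNReal.ofReal (2 * c) :=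
    modular_gradient_div_sqrt_le (M := fun s => s ^ p) (Q := fun s => s ^ r) hc hcore hu hb hb'
      hHb' hUb1
  set k := Real.sqrt (b * b') with hk
  have hk0 : 0 < k := Real.sqrt_pos.2 (by positivity)
  have e : ∫⁻ x in Ω, ENNReal.ofReal (‖gradient u x‖ ^ p * bdist Ω x ^ a) =
      ENNReal.ofReal (k ^ p) *
        ∫⁻ x in Ω, ENNReal.ofReal ((‖gradient u x‖ / k) ^ p * bdist Ω x ^ a) := by
    rw [← lintegral_const_mul' _ _ ENNReal.ofReal_ne_top]
    refine lintegral_congr fun x => ?_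
    rw [← ENNReal.ofReal_mul (by positivity), Real.div_rpow (norm_nonneg _) hk0.le]
    congr 1; field_simp
  calc _ ≤ (ENNReal.ofReal (k ^ p) * ENNReal.ofReal (2 * c)) ^ (2 / p) := by
        rw [e]; gcongr
    _ = ENNReal.ofReal ((k ^ p * (2 * c)) ^ (2 / p)) := by
        rw [← ENNReal.ofReal_mul (by positivity),
          ENNReal.ofReal_rpow_of_nonneg (by positivity) (by positivity)]
    _ = ENNReal.ofReal ((2 * c) ^ (2 / p) * (b * b')) := by
        congr 1
        rw [Real.mul_rpow (by positivity) (by positivity), ← Real.rpow_mul hk0.le,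
          mul_div_cancel₀ _ hp0.ne', Real.rpow_ofNat, hk, Real.sq_sqrt (by positivity), mul_comm]
    _ = _ := ENNReal.ofReal_mul (by positivity)

/-! ### Luxemburg norms -/

lemma lintegral_bdistMeasure {n : ℕ} {Ω : Set (Euc n)} (a : ℝ) (F : Euc n → ℝ≥0∞) :
    ∫⁻ x, F x ∂bdistMeasure Ω a = ∫⁻ x in Ω, F x * ENNReal.ofReal (bdist Ω x ^ a) := by
  rw [bdistMeasure, lintegral_withDensity_eq_lintegral_mul_non_measurable _
    ((continuous_bdist Ω).measurable.pow_const a).ennreal_ofReal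
    (.of_forall fun _ => ENNReal.ofReal_lt_top)]
  simp only [Pi.mul_apply, mul_comm]

lemma lintegral_ofReal_bdistMeasure {n : ℕ} {Ω : Set (Euc n)} (a : ℝ) (F : Euc n → ℝ)
    (hF : ∀ x, 0 ≤ F x) : ∫⁻ x, ENNReal.ofReal (F x) ∂bdistMeasure Ω a =
      ∫⁻ x in Ω, ENNReal.ofReal (F x * bdist Ω x ^ a) := by
  rw [lintegral_bdistMeasure]
  simp only [ENNReal.ofReal_mul (hF _)]

/-- The modular inequality with parameter implies its multiplicative form in Luxemburg norms. Convexity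
turns the bound `2 * c` for the modular into a bound for the norm. -/
theorem luxNorm_gradient_sq_le {n : ℕ} {Ω : Set (Euc n)} (hΩ : IsOpen Ω)
    (hne : (frontier Ω).Nonempty) {q a c : ℝ} (hq : 1 < q) (hc : 0 < c)
    {M Q : ℝ → ℝ} (hM : IsNFunction M) (hQ : IsNFunction Q)
    (h : ∀ u : Euc n → ℝ, IsTestFunction Ω u → ∀ t : ℝ, 0 < t →
      ∫⁻ x in Ω, ENNReal.ofReal (M ‖gradient u x‖ * bdist Ω x ^ a) ≤ ENNReal.ofReal c *
        (ENNReal.ofReal (t ^ q) * (∫⁻ x in Ω, ENNReal.ofReal (hessNorm u x ^ q * bdist Ω x ^ a)) +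
          ∫⁻ x in Ω, ENNReal.ofReal (Q (|u x| / t) * bdist Ω x ^ a)))
    {u : Euc n → ℝ} (hu : IsTestFunction Ω u) :
    luxNorm M (bdistMeasure Ω a) (fun x => ‖gradient u x‖) ^ 2 ≤
      ENNReal.ofReal ((2 * c + 1) ^ 2) *
        eLpNorm (hessNorm u) (ENNReal.ofReal q) (bdistMeasure Ω a) *
        luxNorm Q (bdistMeasure Ω a) u := by
  have hq0 : 0 < q := by linarith
  set H := ∫⁻ x in Ω, ENNReal.ofReal (hessNorm u x ^ q * bdist Ω x ^ a) with hH
  have hHfin : H < ⊤ := hu.lintegral_lt_top hΩ hne a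
    (hu.continuous_hessNorm.rpow_const fun _ => Or.inr hq0.le) fun x hx => by
      rw [IsTestFunction.hessNorm_eq_zero hx, Real.zero_rpow hq0.ne']
  have hLq : eLpNorm (hessNorm u) (ENNReal.ofReal q) (bdistMeasure Ω a) = H ^ q⁻¹ := by
    rw [eLpNorm_eq_lintegral_rpow_enorm_toReal (by simpa using hq0) ENNReal.ofReal_ne_top,
      ENNReal.toReal_ofReal hq0.le, one_div]
    congr 1
    rw [hH, ← lintegral_ofReal_bdistMeasure a _
      fun x => Real.rpow_nonneg (hessNorm_nonneg u x) q]
    refine lintegral_congr fun x => ?_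
    rw [Real.enorm_of_nonneg (hessNorm_nonneg u x),
      ENNReal.ofReal_rpow_of_nonneg (hessNorm_nonneg u x) hq0.le]
  have hQabs : ∀ k : ℝ, 0 < k → ∀ x, |u x / k| = |u x| / k := fun k hk x => by
    rw [abs_div, abs_of_pos hk]
  have hmodQ : ∀ k : ℝ, 0 < k → modular Q (bdistMeasure Ω a) (fun x => u x / k) =
      ∫⁻ x in Ω, ENNReal.ofReal (Q (|u x| / k) * bdist Ω x ^ a) := fun k hk => by
    rw [modular, lintegral_ofReal_bdistMeasure a _ fun x => hQ.nonneg _ (abs_nonneg _)]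
    simp only [hQabs k hk]
  have hUfin : luxNorm Q (bdistMeasure Ω a) u ≠ ⊤ := by
    have h1 : ∫⁻ x in Ω, ENNReal.ofReal (Q |u x| * bdist Ω x ^ a) < ⊤ :=
      hu.lintegral_lt_top hΩ hne a
        (hQ.continuousOn.comp_continuous hu.contDiff_one.continuous.abs fun x => mem_Ici.2 (abs_nonneg _))
        fun x hx => by rw [image_eq_zero_of_notMem_tsupport hx, abs_zero, hQ.apply_zero]
    set I := ∫⁻ x in Ω, ENNReal.ofReal (Q |u x| * bdist Ω x ^ a) with hI
    -- by convexity, the modular of `u / k` is at most `I / k`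
    set k : ℝ := I.toReal + 1 with hk
    have hI0 : 0 ≤ I.toReal := ENNReal.toReal_nonneg
    have hk0 : 0 < k := by positivity
    refine ne_top_of_le_ne_top (ENNReal.ofReal_ne_top (r := k)) (sInf_le ⟨k, hk0, rfl, ?_⟩)
    rw [hmodQ k hk0]
    calc ∫⁻ x in Ω, ENNReal.ofReal (Q (|u x| / k) * bdist Ω x ^ a)
        ≤ ∫⁻ x in Ω, ENNReal.ofReal k⁻¹ * ENNReal.ofReal (Q |u x| * bdist Ω x ^ a) := by
          refine lintegral_mono fun x => ?_
          rw [← ENNReal.ofReal_mul (by positivity), ← mul_assoc]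
          apply ENNReal.ofReal_le_ofReal
          have h2 : 0 ≤ bdist Ω x ^ a := Real.rpow_nonneg Metric.infDist_nonneg a
          refine mul_le_mul_of_nonneg_right ?_ h2
          rw [div_eq_inv_mul]
          exact hQ.apply_mul_le (by positivity) (inv_le_one_of_one_le₀ (by linarith))
            (abs_nonneg _)
      _ = ENNReal.ofReal k⁻¹ * I := lintegral_const_mul' _ _ ENNReal.ofReal_ne_top
      _ = ENNReal.ofReal (k⁻¹ * I.toReal) := by
          rw [ENNReal.ofReal_mul (by positivity), ENNReal.ofReal_toReal h1.ne]
      _ ≤ 1 := by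
          rw [ENNReal.ofReal_le_one, inv_mul_eq_div, div_le_one hk0]
          linarith
  rw [hLq]
  refine le_mul_mul_of_forall_lt ENNReal.ofReal_ne_top
    (ENNReal.rpow_ne_top_of_nonneg (by positivity) hHfin.ne) hUfin fun b b' hb hb' hHb hUb => ?_
  have hHb' : H ≤ ENNReal.ofReal (b ^ q) := by
    rw [← ENNReal.ofReal_rpow_of_nonneg hb.le hq0.le]
    exact (ENNReal.rpow_inv_le_iff hq0).1 hHb.le
  have hUb' : ∫⁻ x in Ω, ENNReal.ofReal (Q (|u x| / b') * bdist Ω x ^ a) ≤ 1 := by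
    obtain ⟨_, ⟨k, hk0, rfl, hk⟩, hkb⟩ := sInf_lt_iff.1 hUb
    have hkb' : k < b' := (ENNReal.ofReal_lt_ofReal_iff hb').1 hkb
    rw [hmodQ k hk0] at hk
    refine le_trans (lintegral_mono fun x => ENNReal.ofReal_le_ofReal ?_) hk
    refine mul_le_mul_of_nonneg_right (hQ.mono (by positivity) (by gcongr))
      (Real.rpow_nonneg Metric.infDist_nonneg a)
  have hmain := modular_gradient_div_sqrt_le hc h hu hb hb' hHb' hUb'
  set k := Real.sqrt (b * b') with hk
  have hk0 : 0 < k := Real.sqrt_pos.2 (by positivity)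
  have hlux : luxNorm M (bdistMeasure Ω a) (fun x => ‖gradient u x‖) ≤
      ENNReal.ofReal ((2 * c + 1) * k) := by
    refine sInf_le ⟨_, by positivity, rfl, ?_⟩
    rw [modular, lintegral_ofReal_bdistMeasure a _ fun x => hM.nonneg _ (abs_nonneg _)]
    calc _ ≤ ∫⁻ x in Ω, ENNReal.ofReal (2 * c + 1)⁻¹ *
          ENNReal.ofReal (M (‖gradient u x‖ / k) * bdist Ω x ^ a) := by
          refine lintegral_mono fun x => ?_
          rw [← ENNReal.ofReal_mul (by positivity), ← mul_assoc]
          apply ENNReal.ofReal_le_ofReal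
          refine mul_le_mul_of_nonneg_right ?_ (Real.rpow_nonneg Metric.infDist_nonneg a)
          rw [abs_of_nonneg (by positivity), show ‖gradient u x‖ / ((2 * c + 1) * k) =
            (2 * c + 1)⁻¹ * (‖gradient u x‖ / k) by field_simp]
          exact hM.apply_mul_le (by positivity) (inv_le_one_of_one_le₀ (by linarith))
            (by positivity)
      _ = ENNReal.ofReal (2 * c + 1)⁻¹ *
          ∫⁻ x in Ω, ENNReal.ofReal (M (‖gradient u x‖ / k) * bdist Ω x ^ a) :=
          lintegral_const_mul' _ _ ENNReal.ofReal_ne_top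
      _ ≤ ENNReal.ofReal (2 * c + 1)⁻¹ * ENNReal.ofReal (2 * c) := by gcongr
      _ ≤ 1 := by
          rw [← ENNReal.ofReal_mul (by positivity), ENNReal.ofReal_le_one, inv_mul_eq_div,
            div_le_one (by positivity)]
          linarith
  calc _ ≤ ENNReal.ofReal ((2 * c + 1) * k) ^ 2 := by gcongr
    _ = ENNReal.ofReal ((2 * c + 1) ^ 2 * (b * b')) := by
        rw [← ENNReal.ofReal_pow (by positivity), mul_pow, hk, Real.sq_sqrt (by positivity)]
    _ = _ := ENNReal.ofReal_mul (by positivity)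

end WeightedGN

theorem theorem6 (n : ℕ) (hn : 1 ≤ n) (Ω : Set (WeightedGN.Euc n))
    (hΩ : WeightedGN.IsBoundedLipschitzDomain Ω) (q a : ℝ) (hq : 1 < q) (ha : a < q - 1) :
    (∀ p r : ℝ, 2 ≤ p → 1 < r → 2 / p = 1 / q + 1 / r →
      ∃ c : ℝ, 0 < c ∧ ∀ u : WeightedGN.Euc n → ℝ, WeightedGN.IsTestFunction Ω u →
        (∫⁻ x in Ω, ENNReal.ofReal (‖gradient u x‖ ^ p * WeightedGN.bdist Ω x ^ a)) ^ (2 / p) ≤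
          ENNReal.ofReal c *
            (∫⁻ x in Ω, ENNReal.ofReal
              (WeightedGN.hessNorm u x ^ q * WeightedGN.bdist Ω x ^ a)) ^ (1 / q) *
            (∫⁻ x in Ω, ENNReal.ofReal (|u x| ^ r * WeightedGN.bdist Ω x ^ a)) ^ (1 / r)) ∧
    (∀ (M Q : ℝ → ℝ) (c₀ : ℝ), WeightedGN.ConditionM M → WeightedGN.IsNFunction Q →
      (∀ s v w : ℝ, 0 < s → 0 < v → 0 < w →
        M s / s ^ 2 * (v * w) ≤ M s + c₀ * v ^ q + Q w) →
      ∃ c : ℝ, 0 < c ∧ ∀ u : WeightedGN.Euc n → ℝ, WeightedGN.IsTestFunction Ω u →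
        (∫⁻ x in Ω, ENNReal.ofReal (M ‖gradient u x‖ * WeightedGN.bdist Ω x ^ a) ≤
          ENNReal.ofReal c *
            ((∫⁻ x in Ω, ENNReal.ofReal
                (WeightedGN.hessNorm u x ^ q * WeightedGN.bdist Ω x ^ a)) +
              ∫⁻ x in Ω, ENNReal.ofReal (Q |u x| * WeightedGN.bdist Ω x ^ a))) ∧
        WeightedGN.luxNorm M (WeightedGN.bdistMeasure Ω a) (fun x => ‖gradient u x‖) ^ 2 ≤
          ENNReal.ofReal c *
            MeasureTheory.eLpNorm (WeightedGN.hessNorm u) (ENNReal.ofReal q)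
              (WeightedGN.bdistMeasure Ω a) *
            WeightedGN.luxNorm Q (WeightedGN.bdistMeasure Ω a) u) := by
  refine ⟨fun p r hp hr hpqr => WeightedGN.exists_gradient_rpow_le hn hΩ hq ha hp hr hpqr,
    fun M Q c₀ hM hQ hMQ => ?_⟩
  have hN := hM.isNFunction
  obtain ⟨C, hC, hC'⟩ := hM.exists_abs_deriv_mul_le
  obtain ⟨c, hc, hcore⟩ := WeightedGN.exists_modular_gradient_le hn hΩ hq ha (c₀ := max c₀ 0)
    hN.continuousOn hN.apply_zero hN.nonneg hM.contDiffOn hC hC' hQ.continuousOn hQ.nonneg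
    (le_max_right _ _) (fun s v w hs hv hw => (hMQ s v w hs hv hw).trans (by
      gcongr
      exact le_max_left _ _))
  have hle : c ≤ (2 * c + 1) ^ 2 := by nlinarith
  refine ⟨(2 * c + 1) ^ 2, by positivity, fun u hu => ⟨?_, ?_⟩⟩
  · have h := hcore u hu 1 one_pos
    simp only [Real.one_rpow, ENNReal.ofReal_one, one_mul, div_one] at h
    exact h.trans (by gcongr)
  · exact WeightedGN.luxNorm_gradient_sq_le hΩ.isOpen (hΩ.frontier_nonempty hn) hq hc hN hQ
      hcore hu
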